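/- Let $r, n, d \ge 0$ be integers, and let $U$ and $V$ be totally ordered sets with $|U| = |V| = n$. A bipartite multigraph on $U$ and $V$ is given by the multiplicities of the edges $uv$ ($u\in U$, $v\in V$); it is $r$-regular if every vertex has degree $r$, counted with multiplicity. Two edges $uv$, $u'v'$ are noncrossing if $u<u'$ and $v<v'$, or $u'<u$ and $v'<v$. A planar matching is a set of edges any two distinct members of which are noncrossing. Let $G_r(U,V;d)$ be the set of $r$-regular bipartite multigraphs on $U$ and $V$ whose largest planar matching has at most $d$ edges. Its cardinality depends on $U$ and $V$ only through $n$ and is denoted by $g_r(n;d)$. An $r$-configuration is a bijection between $U\times[r]$ and $V\times[r]$, regarded as a set of pairs; write $u^a=(u,a)$ and $v^b=(v,b)$. Ordering both products lexicographically and identifying each with $[rn]$ in the order-preserving way, one views an $r$-configuration as a permutation of $[rn]$. To an $r$-regular multigraph $G$ one associates the $r$-configuration $\overline G$ that projects to $G$ when second coordinates are forgotten and such that, whenever $uv$ is an edge of multiplicity $t$, $i$ edges $uv'$ of $G$ have $v'>v$, and $j$ edges $u'v$ of $G$ have $u'>u$, the pair $(u^{i+s}, v^{j+t-s+1})$ belongs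 to $\overline G$ for every $1\le s\le t$. Let $\overline G_r(U,V;d)=\{\overline G : G\in G_r(U,V;d)\}$. Say that a standard Young tableau with entry set $[rn]$ (each entry occurring exactly once) satisfies condition (T) if for all $1\le i\le n$ and $1\le s<r$ the row containing $r(i-1)+s$ is strictly above the row containing $r(i-1)+s+1$. **Theorem.** The Robinson–Schensted–Knuth correspondence $\pi\mapsto(P(\pi),Q(\pi))$ (successive row insertion of $\pi(1),\dots,\pi(rn)$ yields $P$, and $Q$ records the order in which the boxes are created) restricts to a bijection from $\overline G_r(U,V;d)$ onto the set of pairs of standard Young tableaux of equal shape, with entry set $[rn]$ and at most $d$ columns, both of which satisfy condition (T). In particular, $g_r(n;d)$ equals the number of such pairs. -/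

import Mathlib

namespace PlanarMatching

/-! ### Bipartite multigraphs on two ordered colour classes -/

/-- A bipartite multigraph with colour classes `U` and `V`: `G u v` is the multiplicity of the edge
`uv`. Vertices are labelled, parallel edges are indistinguishable. -/
abbrev BipMultigraph (U V : Type*) : Type _ := U → V → ℕ

section Multigraph

variable {U V : Type*} [Fintype U] [LinearOrder U] [Fintype V] [LinearOrder V]

/-- Every vertex has degree `r`, edges being counted with multiplicity. -/
def IsRegular (r : ℕ) (G : BipMultigraph U V) : Prop :=
  (∀ u, ∑ v, G u v = r) ∧ (∀ v, ∑ u, G u v = r)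

/-- The edges `e = uv` and `e' = u'v'` are noncrossing: `u, u'` are in the same strict order as
`v, v'`. Noncrossing edges share no endpoint; in particular parallel edges are not noncrossing. -/
def Noncrossing (e e' : U × V) : Prop :=
  (e.1 < e'.1 ∧ e.2 < e'.2) ∨ (e'.1 < e.1 ∧ e'.2 < e.2)

/-- `M` is a planar matching of `G`: a set of edges of `G`, any two distinct ones being noncrossing
(hence vertex-disjoint). As a matching uses at most one of several parallel edges, it is determined
by the set of its pairs of endpoints. -/
def IsPlanarMatching (G : BipMultigraph U V) (M : Finset (U × V)) : Prop :=
  (∀ e ∈ M, 0 < G e.1 e.2) ∧ (M : Set (U × V)).Pairwise Noncrossing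

open Classical in
/-- `L(G)`, the number of edges of a largest planar matching of `G`. -/
noncomputable def largestPlanarMatching (G : BipMultigraph U V) : ℕ :=
  (Finset.univ.filter (fun M : Finset (U × V) => IsPlanarMatching G M)).sup Finset.card

variable (U V) in
/-- `G_r(U, V; d)`: the `r`-regular bipartite multigraphs on `U` and `V` whose largest planar
matching has at most `d` edges. -/
def planarMultigraphs (r d : ℕ) : Set (BipMultigraph U V) :=
  {G | IsRegular r G ∧ largestPlanarMatching G ≤ d}

/-! ### Configurations -/

variable (U V) in
/-- An `r`-configuration of `U` and `V`: a one-to-one pairing of `U × [r]` with `V × [r]`; both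
products carry the lexicographic order. The element `u^a` of `U × [r]`, with `1 ≤ a ≤ r`, is
`toLex (u, a - 1)`. -/
abbrev Configuration (r : ℕ) : Type _ := (U ×ₗ Fin r) ≃ (V ×ₗ Fin r)

/-- The multigraph onto which a configuration projects (forgetting the second coordinates). -/
def Configuration.proj {r : ℕ} (F : Configuration U V r) : BipMultigraph U V :=
  fun u v => (Finset.univ.filter (fun a : Fin r => (ofLex (F (toLex (u, a)))).1 = v)).card

/-- `F` is the configuration associated to the multigraph `G`: it projects to `G`, and if `uv` is an
edge of multiplicity `t`, there are `i` edges `uv'` with `v < v'` and `j` edges `u'v` with `u < u'`,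
then for every `1 ≤ s ≤ t` the vertex `u^(i+s)` is paired with `v^(j+t-s+1)`. -/
def IsAssociated {r : ℕ} (G : BipMultigraph U V) (F : Configuration U V r) : Prop :=
  F.proj = G ∧
  ∀ u v, ∀ s ∈ Finset.Icc 1 (G u v), ∃ a b : Fin r,
    (a : ℕ) + 1 = (∑ v' ∈ Finset.univ.filter (fun v' => v < v'), G u v') + s ∧
    (b : ℕ) + 1 = (∑ u' ∈ Finset.univ.filter (fun u' => u < u'), G u' v) + (G u v - s) + 1 ∧
    F (toLex (u, a)) = toLex (v, b)

variable (U V) in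
/-- The configurations associated to the members of `G_r(U, V; d)`. -/
def planarConfigurations (r d : ℕ) : Set (Configuration U V r) :=
  {F | ∃ G ∈ planarMultigraphs U V r d, IsAssociated G F}

end Multigraph

/-- `g_r(n; d)`: the number of `r`-regular bipartite multigraphs on two colour classes of size `n`
whose largest planar matching has at most `d` edges. -/
noncomputable def numPlanarMultigraphs (r n d : ℕ) : ℕ :=
  (planarMultigraphs (Fin n) (Fin n) r d).ncard

/-! ### Young tableaux -/

/-- The shape of an array of left-justified rows (listed from top to bottom): its row lengths. -/
def shape (T : List (List ℕ)) : List ℕ := T.map List.length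

/-- The number of columns of a tableau: the length of its first row. -/
def numColumns (T : List (List ℕ)) : ℕ := (T.headD []).length

/-- `T`, given by its list of rows, is a standard Young tableau: no listed row is empty, the row
lengths are weakly decreasing, the entries are distinct, and they increase from left to right in
every row and from top to bottom in every column. -/
def IsYoungTableau (T : List (List ℕ)) : Prop :=
  (∀ R ∈ T, R ≠ []) ∧
  (shape T).Pairwise (· ≥ ·) ∧
  T.flatten.Nodup ∧
  (∀ R ∈ T, R.Pairwise (· < ·)) ∧
  T.Pairwise (fun R R' => ∀ (j : ℕ) (h : j < R.length) (h' : j < R'.length), R[j] < R'[j])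

/-- `T(S; d)`: the standard Young tableaux with set of entries `S` (each element of `S` occurs
exactly once) and with at most `d` columns. -/
def tableaux (S : Finset ℕ) (d : ℕ) : Set (List (List ℕ)) :=
  {T | IsYoungTableau T ∧ T.flatten.toFinset = S ∧ numColumns T ≤ d}

/-- The entry `x` lies in row `k` of `T`, where rows are numbered from `0` downwards. -/
def InRow (T : List (List ℕ)) (k x : ℕ) : Prop :=
  ∃ R, T[k]? = some R ∧ x ∈ R

/-- Condition (T): for all `1 ≤ i ≤ n` and `1 ≤ s < r`, the row containing `r(i-1)+s` is strictly
above the row containing `r(i-1)+s+1`. -/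
def ConditionT (r n : ℕ) (T : List (List ℕ)) : Prop :=
  ∀ i ∈ Finset.Icc 1 n, ∀ s ∈ Finset.Ico 1 r,
    ∃ k l, InRow T k (r * (i - 1) + s) ∧ InRow T l (r * (i - 1) + s + 1) ∧ k < l

/-- The pairs of tableaux of the same shape in `T([rn]; d)` that both satisfy condition (T). -/
def tableauPairs (r n d : ℕ) : Set (List (List ℕ) × List (List ℕ)) :=
  {PQ | PQ.1 ∈ tableaux (Finset.Icc 1 (r * n)) d ∧ PQ.2 ∈ tableaux (Finset.Icc 1 (r * n)) d ∧
    shape PQ.1 = shape PQ.2 ∧ ConditionT r n PQ.1 ∧ ConditionT r n PQ.2}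

/-! ### The Robinson–Schensted–Knuth correspondence -/

/-- Insert `x` into a row: `x` replaces the leftmost entry larger than `x`, which is bumped out
(second component); if there is none, `x` is put at the end of the row and nothing is bumped. -/
def bump : List ℕ → ℕ → List ℕ × Option ℕ
  | [], x => ([x], none)
  | y :: R, x => if x < y then (x :: R, some y) else (y :: (bump R x).1, (bump R x).2)

/-- Row insertion `T ← x`: insert `x` into the first row, the bumped entry into the next row, and so
on until nothing is bumped; a new row is started below the last one if necessary. -/
def rowInsert : List (List ℕ) → ℕ → List (List ℕ)
  | [], x => [[x]]
  | R :: T, x =>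
    match (bump R x).2 with
    | none => (bump R x).1 :: T
    | some y => (bump R x).1 :: rowInsert T y

/-- The row (numbered from `0`) of the box created by the row insertion `T ← x`. -/
def newBoxRow : List (List ℕ) → ℕ → ℕ
  | [], _ => 0
  | R :: T, x =>
    match (bump R x).2 with
    | none => 0
    | some y => newBoxRow T y + 1

/-- Place `a` into a new box at the end of row `k` of `T` (a new bottom row if `T` has `k` rows). -/
def placeAt : List (List ℕ) → ℕ → ℕ → List (List ℕ)
  | [], _, a => [[a]]
  | R :: T, 0, a => (R ++ [a]) :: T
  | R :: T, k + 1, a => R :: placeAt T k a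

/-- One step of the algorithm: `xi = (x, i)` inserts `x` into the first tableau and places `i` into
the corresponding new box of the second. -/
def rskStep (PQ : List (List ℕ) × List (List ℕ)) (xi : ℕ × ℕ) : List (List ℕ) × List (List ℕ) :=
  (rowInsert PQ.1 xi.1, placeAt PQ.2 (newBoxRow PQ.1 xi.1) xi.2)

/-- The pair `(P, Q)` of the permutation `π` of `[m]`: successively insert `π(1), …, π(m)`. -/
def rskPerm {m : ℕ} (π : Equiv.Perm (Fin m)) : List (List ℕ) × List (List ℕ) :=
  (List.ofFn (fun i : Fin m => ((π i : ℕ) + 1, (i : ℕ) + 1))).foldl rskStep ([], [])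

section Config

variable {U V : Type*} [Fintype U] [LinearOrder U] [Fintype V] [LinearOrder V]

/-- The order-preserving identification of `[rn]` with `U × [r]` (lexicographically ordered), where
`U` has `n` elements. -/
def finOrderIso (r : ℕ) {n : ℕ} (hU : Fintype.card U = n) : Fin (r * n) ≃o (U ×ₗ Fin r) :=
  monoEquivOfFin (U ×ₗ Fin r) (by
    rw [Fintype.card_lex, Fintype.card_prod, Fintype.card_fin, hU, mul_comm])

/-- A configuration viewed as a permutation of `[rn]`. -/
def Configuration.toPerm {r n : ℕ} (hU : Fintype.card U = n) (hV : Fintype.card V = n)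
    (F : Configuration U V r) : Equiv.Perm (Fin (r * n)) :=
  ((finOrderIso r hU).toEquiv.trans F).trans (finOrderIso r hV).symm.toEquiv

/-- The pair of tableaux that the RSK correspondence associates to a configuration. -/
def rsk {r n : ℕ} (hU : Fintype.card U = n) (hV : Fintype.card V = n)
    (F : Configuration U V r) : List (List ℕ) × List (List ℕ) :=
  rskPerm (F.toPerm hU hV)

end Config

end PlanarMatching

/-!
The Robinson–Schensted–Knuth correspondence is a bijection between the permutations of `[m]` and the
pairs of standard tableaux of equal shape with entry set `[m]`. The theorem holds because the three
conditions on a configuration translate exactly into conditions on its pair `(P, Q)`.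

* A configuration `F` is associated to a regular multigraph if and only if it is decreasing on every
  block `{u} × [r]` and its inverse is decreasing on every block `{v} × [r]`; the multigraph is then
  the projection of `F`, and determines `F` (`IsAssociated.isBlockDecreasing`, `isAssociated_proj`,
  `IsAssociated.unique`, `IsRegular.exists_isAssociated`).
* The letter `i + 1` lies strictly below `i` in `Q` if and only if `π(i) > π(i + 1)`, and in `P` if
  and only if `i + 1` precedes `i` in `π`. So condition (T) for `Q` says that `F` is decreasing on
  the blocks, and for `P` that its inverse is. The statement on `Q` is the row bumping lemma
  (`newBoxRow_lt_of_lt`, `newBoxRow_le_of_le`). For `P`, row insertion preserves the relative order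
  of consecutive values in the reading word (`filter_bump`).
* By Schensted's theorem the number of columns is the length of a longest increasing subsequence
  (`numColumns_rskWord_le_iff`). When `F` is decreasing on the blocks of both sides, an increasing
  subsequence meets every block at most once, and therefore projects to a planar matching of the
  same size; conversely, planar matchings lift (`largestPlanarMatching_proj_le_iff`).

The bijectivity of the correspondence is proved for words, by reversing a single row insertion:
insertion is injective once the new box is known (`rowInsert_injective`), and reverse bumping from
any corner succeeds (`exists_rowInsert_eq`).
-/

namespace PlanarMatching

/-! ### Row bumping -/

/-- `S` may stand below `R` with respect to `r`: `S` is at most as long as `R`, and every entry of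
`S` is related to the entry of `R` at the same place. -/
def Dominates (r : ℕ → ℕ → Prop) : List ℕ → List ℕ → Prop
  | _, [] => True
  | [], _ :: _ => False
  | a :: R, b :: S => r a b ∧ Dominates r R S

@[simp] lemma dominates_nil (r : ℕ → ℕ → Prop) (R : List ℕ) : Dominates r R [] := by
  cases R <;> trivial

@[simp] lemma not_dominates_nil_cons (r : ℕ → ℕ → Prop) (b : ℕ) (S : List ℕ) :
    ¬ Dominates r [] (b :: S) := id

@[simp] lemma dominates_cons_cons (r : ℕ → ℕ → Prop) (a b : ℕ) (R S : List ℕ) :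
    Dominates r (a :: R) (b :: S) ↔ r a b ∧ Dominates r R S := Iff.rfl

lemma dominates_iff (r : ℕ → ℕ → Prop) (R S : List ℕ) :
    Dominates r R S ↔ S.length ≤ R.length ∧
      ∀ (j : ℕ) (h : j < R.length) (h' : j < S.length), r R[j] S[j] := by
  induction R generalizing S with
  | nil => cases S <;> simp
  | cons a R ih =>
    cases S with
    | nil => simp
    | cons b S =>
      rw [dominates_cons_cons, ih]
      constructor
      · rintro ⟨hab, hl, hj⟩
        refine ⟨by simpa using hl, ?_⟩
        rintro (_ | j) h h'
        · simpa using hab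
        · simpa using hj j (by simpa using h) (by simpa using h')
      · rintro ⟨hl, hj⟩
        refine ⟨hj 0 (by simp) (by simp), by simpa using hl, fun j h h' => ?_⟩
        exact hj (j + 1) (by simpa using h) (by simpa using h')

lemma bump_cons_of_lt {a x : ℕ} (R : List ℕ) (h : x < a) :
    bump (a :: R) x = (x :: R, some a) := by
  simp only [bump, h, if_true]

lemma bump_cons_of_not_lt {a x : ℕ} (R : List ℕ) (h : ¬ x < a) :
    bump (a :: R) x = (a :: (bump R x).1, (bump R x).2) := by
  simp only [bump, h, if_false]

lemma bump_eq_append_of_none {R : List ℕ} {x : ℕ} (h : (bump R x).2 = none) :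
    (bump R x).1 = R ++ [x] := by
  induction R with
  | nil => rfl
  | cons a R ih =>
    by_cases hx : x < a
    · simp [bump_cons_of_lt R hx] at h
    · simp only [bump_cons_of_not_lt R hx] at h ⊢
      rw [ih h, List.cons_append]

lemma le_of_bump_eq_none {R : List ℕ} {x : ℕ} (h : (bump R x).2 = none) :
    ∀ a ∈ R, a ≤ x := by
  induction R with
  | nil => simp
  | cons a R ih =>
    by_cases hx : x < a <;> simp_all [bump]

lemma bump_eq_none_of_le {R : List ℕ} {x : ℕ} (h : ∀ a ∈ R, a ≤ x) :
    (bump R x).2 = none := by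
  induction R with
  | nil => rfl
  | cons a R ih =>
    have : ¬ x < a := not_lt.2 (h a (by simp))
    rw [bump_cons_of_not_lt R this]
    exact ih fun b hb => h b (by simp [hb])

lemma mem_of_bump_eq_some {R : List ℕ} {x y : ℕ} (h : (bump R x).2 = some y) : y ∈ R := by
  induction R with
  | nil => simp [bump] at h
  | cons a R ih =>
    by_cases hx : x < a <;> simp_all [bump]

lemma lt_of_bump_eq_some {R : List ℕ} {x y : ℕ} (h : (bump R x).2 = some y) : x < y := by
  induction R with
  | nil => simp [bump] at h
  | cons a R ih =>
    by_cases hx : x < a <;> simp_all [bump]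

lemma bump_perm_of_some {R : List ℕ} {x y : ℕ} (h : (bump R x).2 = some y) :
    (y :: (bump R x).1).Perm (R ++ [x]) := by
  induction R with
  | nil => simp [bump] at h
  | cons a R ih =>
    by_cases hx : x < a
    · simp only [bump, hx, if_true, Option.some.injEq] at h ⊢
      subst h
      simpa using (List.perm_append_singleton x R).symm
    · simp only [bump, hx, if_false] at h ⊢
      exact (List.Perm.swap a y _).trans ((ih h).cons a)

lemma mem_bump {R : List ℕ} {x z : ℕ} (h : z ∈ (bump R x).1) : z = x ∨ z ∈ R := by
  induction R with
  | nil => simpa [bump] using h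
  | cons a R ih =>
    by_cases hx : x < a
    · simp only [bump, hx, if_true, List.mem_cons] at h ⊢
      tauto
    · simp only [bump, hx, if_false, List.mem_cons] at h ⊢
      tauto

lemma bump_ne_nil (R : List ℕ) (x : ℕ) : (bump R x).1 ≠ [] := by
  cases R with
  | nil => simp [bump]
  | cons a R => by_cases hx : x < a <;> simp [bump, hx]

lemma bump_sorted {R : List ℕ} (hR : R.Pairwise (· ≤ ·)) (x : ℕ) :
    (bump R x).1.Pairwise (· ≤ ·) := by
  induction R with
  | nil => simp [bump]
  | cons a R ih =>
    rw [List.pairwise_cons] at hR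
    by_cases hx : x < a
    · simp only [bump, hx, if_true, List.pairwise_cons]
      exact ⟨fun b hb => hx.le.trans (hR.1 b hb), hR.2⟩
    · simp only [bump, hx, if_false, List.pairwise_cons]
      refine ⟨fun b hb => ?_, ih hR.2⟩
      rcases mem_bump hb with rfl | hb
      · exact not_lt.1 hx
      · exact hR.1 b hb

/-- Bumping does not increase the entry at any place of the row. -/
lemma Dominates.bump {r : ℕ → ℕ → Prop} (hr : ∀ {a b c}, a < b → r b c → r a c)
    {R S : List ℕ} (h : Dominates r R S) (x : ℕ) :
    Dominates r (PlanarMatching.bump R x).1 S := by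
  induction R generalizing S with
  | nil => cases S <;> simp_all
  | cons a R ih =>
    cases S with
    | nil => simp
    | cons b S =>
      by_cases hx : x < a
      · simpa [PlanarMatching.bump, hx, h.2] using hr hx h.1
      · simpa [PlanarMatching.bump, hx, h.1] using ih h.2

/-- Two rows remain column strict when an entry bumped out of the first is inserted into the
second. -/
lemma Dominates.bump_bump {R S : List ℕ} (hR : R.Pairwise (· ≤ ·)) (h : Dominates (· < ·) R S)
    {x y : ℕ} (hy : (PlanarMatching.bump R x).2 = some y) :
    Dominates (· < ·) (PlanarMatching.bump R x).1 (PlanarMatching.bump S y).1 := by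
  induction R generalizing S with
  | nil => simp [PlanarMatching.bump] at hy
  | cons a R ih =>
    rw [List.pairwise_cons] at hR
    by_cases hx : x < a
    · simp only [PlanarMatching.bump, hx, if_true, Option.some.injEq] at hy ⊢
      subst hy
      cases S with
      | nil => simpa [PlanarMatching.bump] using hx
      | cons b S =>
        obtain ⟨hab, h⟩ := h
        simpa [PlanarMatching.bump, hab, hx] using h
    · have hxy := lt_of_bump_eq_some hy
      simp only [PlanarMatching.bump, hx, if_false] at hy ⊢
      have hay : a < y := by omega
      cases S with
      | nil => simpa [PlanarMatching.bump] using hay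
      | cons b S =>
        obtain ⟨hab, h⟩ := h
        by_cases hyb : y < b
        · simp only [PlanarMatching.bump, hyb, if_true, dominates_cons_cons]
          exact ⟨hay, Dominates.bump (r := (· < ·)) (fun h₁ h₂ => lt_trans h₁ h₂) h x⟩
        · simp only [PlanarMatching.bump, hyb, if_false, dominates_cons_cons]
          exact ⟨hab, ih hR.2 h hy⟩

/-- Reverse bumping: `y` replaces the rightmost entry smaller than `y`, which is thrown out of the
row (second component). This makes sense only if the first entry is smaller than `y`, a condition
expressed as `R.headD y < y`, which also forces `R` to be nonempty. -/
def unbump : List ℕ → ℕ → List ℕ × ℕ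
  | [], y => ([], y)
  | a :: R, y =>
    if R.headD y < y then (a :: (unbump R y).1, (unbump R y).2) else (y :: R, a)

lemma unbump_cons_of_lt {R : List ℕ} {y : ℕ} (a : ℕ) (h : R.headD y < y) :
    unbump (a :: R) y = (a :: (unbump R y).1, (unbump R y).2) := by
  simp only [unbump, h, if_true]

lemma unbump_cons_of_not_lt {R : List ℕ} {y : ℕ} (a : ℕ) (h : ¬ R.headD y < y) :
    unbump (a :: R) y = (y :: R, a) := by
  simp only [unbump, h, if_false]

lemma unbump_mem {R : List ℕ} {y : ℕ} (h : R.headD y < y) : (unbump R y).2 ∈ R := by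
  induction R with
  | nil => simp at h
  | cons a R ih =>
    by_cases hR : R.headD y < y
    · simpa [unbump_cons_of_lt a hR] using Or.inr (ih hR)
    · simp [unbump_cons_of_not_lt a hR]

lemma mem_unbump {R : List ℕ} {y z : ℕ} (h : z ∈ (unbump R y).1) : z = y ∨ z ∈ R := by
  induction R with
  | nil => simp [unbump] at h
  | cons a R ih =>
    by_cases hR : R.headD y < y
    · simp only [unbump, hR, if_true, List.mem_cons] at h ⊢
      tauto
    · simp only [unbump, hR, if_false, List.mem_cons] at h ⊢
      tauto

lemma unbump_length (R : List ℕ) (y : ℕ) : (unbump R y).1.length = R.length := by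
  induction R with
  | nil => rfl
  | cons a R ih => 
    by_cases hR : R.headD y < y
    · simp [unbump_cons_of_lt a hR, ih]
    · simp [unbump_cons_of_not_lt a hR]

lemma unbump_sorted {R : List ℕ} (hR : R.Pairwise (· ≤ ·)) {y : ℕ} (h : R.headD y < y) :
    (unbump R y).1.Pairwise (· ≤ ·) := by
  induction R with
  | nil => simp [unbump]
  | cons a R ih =>
    rw [List.pairwise_cons] at hR
    by_cases hy : R.headD y < y
    · simp only [unbump, hy, if_true, List.pairwise_cons]
      refine ⟨fun b hb => ?_, ih hR.2 hy⟩
      rcases mem_unbump hb with rfl | hb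
      · exact le_of_lt (by simpa using h)
      · exact hR.1 b hb
    · simp only [unbump, hy, if_false, List.pairwise_cons]
      refine ⟨fun b hb => ?_, hR.2⟩
      cases R with
      | nil => simp at hb
      | cons c R =>
        rw [List.pairwise_cons] at hR
        simp only [List.headD_cons, not_lt] at hy
        rcases List.mem_cons.1 hb with rfl | hb
        · exact hy
        · exact hy.trans (hR.2.1 b hb)

lemma bump_unbump {R : List ℕ} (hR : R.Pairwise (· ≤ ·)) {y : ℕ} (h : R.headD y < y) :
    bump (unbump R y).1 (unbump R y).2 = (R, some y) := by
  induction R with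
  | nil => simp at h
  | cons a R ih =>
    rw [List.pairwise_cons] at hR
    by_cases hy : R.headD y < y
    · have := hR.1 _ (unbump_mem hy)
      rw [unbump_cons_of_lt a hy, bump_cons_of_not_lt _ this.not_gt, ih hR.2 hy]
    · simp only [List.headD_cons] at h
      rw [unbump_cons_of_not_lt a hy, bump_cons_of_lt _ h]

lemma unbump_bump {R : List ℕ} (hR : R.Pairwise (· ≤ ·)) {x y : ℕ} (h : (bump R x).2 = some y) :
    unbump (bump R x).1 y = (R, x) := by
  induction R with
  | nil => simp [bump] at h
  | cons a R ih =>
    rw [List.pairwise_cons] at hR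
    by_cases hx : x < a
    · simp only [bump, hx, if_true, Option.some.injEq] at h ⊢
      subst h
      have : ¬ R.headD a < a := by
        cases R with
        | nil => simp
        | cons c R => simpa using hR.1 c (by simp)
      simp only [unbump, this, if_false]
    · have hxy := lt_of_bump_eq_some h
      simp only [bump, hx, if_false] at h ⊢
      have : (bump R x).1.headD y < y := by
        cases R with
        | nil => simp [bump] at h
        | cons c R => by_cases hc : x < c <;> simp [bump, hc] <;> omega
      simp only [unbump, this, if_true, ih hR.2 h]

lemma Dominates.headD_lt {R S : List ℕ} (h : Dominates (· < ·) R S) {y : ℕ} (hS : S.headD y ≤ y)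
    (hne : S ≠ []) : R.headD y < y := by
  cases S with
  | nil => exact absurd rfl hne
  | cons b S =>
    cases R with
    | nil => simp at h
    | cons a R => exact lt_of_lt_of_le h.1 hS

lemma Dominates.unbump_left {R S : List ℕ} {b : ℕ} (h : Dominates (· < ·) R S)
    (hS : ∀ c ∈ S, b < c) : Dominates (· < ·) (unbump R b).1 S := by
  induction R generalizing S with
  | nil => simpa [unbump] using h
  | cons a R ih =>
    cases S with
    | nil => simp
    | cons c S =>
      by_cases hb : R.headD b < b
      · simp only [unbump, hb, if_true, dominates_cons_cons]
        exact ⟨h.1, ih h.2 fun c hc => hS c (by simp [hc])⟩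
      · simp only [unbump, hb, if_false, dominates_cons_cons]
        exact ⟨hS c (by simp), h.2⟩

/-- Two rows remain column strict when an entry thrown out of the second by reverse bumping is
reversely bumped into the first. -/
lemma Dominates.unbump_unbump {R S : List ℕ} (hS : S.Pairwise (· ≤ ·))
    (h : Dominates (· < ·) R S) {z : ℕ} (hz : S.headD z < z) :
    Dominates (· < ·) (unbump R (unbump S z).2).1 (unbump S z).1 := by
  induction S generalizing R with
  | nil => simp at hz
  | cons b S ih =>
    rw [List.pairwise_cons] at hS
    cases R with
    | nil => simp at h
    | cons a R =>
      obtain ⟨hab, h⟩ := h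
      simp only [List.headD_cons] at hz
      by_cases hy : S.headD z < z
      · have hne : S ≠ [] := by rintro rfl; simp at hy
        have hhead : R.headD (unbump S z).2 < (unbump S z).2 := by
          refine h.headD_lt ?_ hne
          have hm := unbump_mem hy
          cases S with
          | nil => exact absurd rfl hne
          | cons c S =>
            rcases List.mem_cons.1 hm with hm | hm
            · simp [hm]
            · exact (List.pairwise_cons.1 hS.2).1 _ hm
        simp only [unbump, hy, if_true, hhead, dominates_cons_cons]
        exact ⟨hab, ih hS.2 h hy⟩
      · have hlt : ∀ c ∈ S, b < c := by
          intro c hc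
          cases S with
          | nil => simp at hc
          | cons e S =>
            simp only [List.headD_cons, not_lt] at hy
            rcases List.mem_cons.1 hc with rfl | hc
            · omega
            · have := (List.pairwise_cons.1 hS.2).1 _ hc
              omega
        by_cases hb : R.headD b < b
        · simp only [unbump, hy, if_false, hb, if_true, dominates_cons_cons]
          exact ⟨hab.trans hz, h.unbump_left hlt⟩
        · simp only [unbump, hy, if_false, hb, dominates_cons_cons]
          exact ⟨hz, h⟩

lemma headD_append_singleton_le {S : List ℕ} {y : ℕ} (hS : (S ++ [y]).Pairwise (· ≤ ·)) :
    (S ++ [y]).headD y ≤ y := by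
  cases S with
  | nil => simp
  | cons b S => exact (List.pairwise_cons.1 hS).1 y (by simp)

/-- Two rows remain column strict when the last entry of the second is reversely bumped into the
first. -/
lemma Dominates.unbump_last {R S : List ℕ} {y : ℕ} (hS : (S ++ [y]).Pairwise (· ≤ ·))
    (h : Dominates (· < ·) R (S ++ [y])) : Dominates (· < ·) (unbump R y).1 S := by
  induction S generalizing R with
  | nil => simp
  | cons b S ih =>
    rw [List.cons_append, List.pairwise_cons] at hS
    cases R with
    | nil => simp at h
    | cons a R =>
      obtain ⟨hab, h⟩ := h
      have hhead : R.headD y < y :=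
        Dominates.headD_lt h (headD_append_singleton_le hS.2) (by simp)
      simp only [unbump, hhead, if_true, dominates_cons_cons]
      exact ⟨hab, ih hS.2 h⟩

lemma Dominates.append_left {r : ℕ → ℕ → Prop} {R S : List ℕ} (h : Dominates r R S)
    (R' : List ℕ) : Dominates r (R ++ R') S := by
  induction R generalizing S with
  | nil => cases S <;> simp_all
  | cons a R ih =>
    cases S with
    | nil => simp
    | cons b S => exact ⟨h.1, ih h.2⟩

lemma Dominates.of_append_left {r : ℕ → ℕ → Prop} {R R' S : List ℕ} (h : Dominates r (R ++ R') S)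
    (hl : S.length ≤ R.length) : Dominates r R S := by
  rw [dominates_iff] at h ⊢
  refine ⟨hl, fun j hj hj' => ?_⟩
  have := h.2 j (by simp; omega) hj'
  rwa [List.getElem_append_left hj] at this

lemma Dominates.of_append_right {r : ℕ → ℕ → Prop} {R S S' : List ℕ}
    (h : Dominates r R (S ++ S')) : Dominates r R S := by
  induction R generalizing S with
  | nil => cases S <;> simp_all
  | cons a R ih =>
    cases S with
    | nil => simp
    | cons b S => exact ⟨h.1, ih h.2⟩

lemma Dominates.append_right {r : ℕ → ℕ → Prop} {R S : List ℕ} {m : ℕ} (h : Dominates r R S)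
    (hl : S.length < R.length) (hm : ∀ a ∈ R, r a m) : Dominates r R (S ++ [m]) := by
  induction R generalizing S with
  | nil => simp at hl
  | cons a R ih =>
    cases S with
    | nil => simpa using hm a (by simp)
    | cons b S =>
      exact ⟨h.1, ih h.2 (by simpa using hl) fun c hc => hm c (by simp [hc])⟩

/-! ### Row insertion into tableaux with weakly increasing rows -/

/-- `T` has nonempty weakly increasing rows of weakly decreasing lengths, and its columns are
strictly increasing. Row insertion is reversible on these semistandard tableaux, so that the
distinctness of the entries need not be carried along. -/
def IsSemistandard : List (List ℕ) → Prop
  | [] => True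
  | R :: T => R ≠ [] ∧ R.Pairwise (· ≤ ·) ∧ Dominates (· < ·) R (T.headD []) ∧ IsSemistandard T

lemma rowInsert_cons_of_none {R : List ℕ} {x : ℕ} (T : List (List ℕ)) (h : (bump R x).2 = none) :
    rowInsert (R :: T) x = (R ++ [x]) :: T := by
  simp [rowInsert, h, bump_eq_append_of_none h]

lemma rowInsert_cons_of_some {R : List ℕ} {x y : ℕ} (T : List (List ℕ))
    (h : (bump R x).2 = some y) : rowInsert (R :: T) x = (bump R x).1 :: rowInsert T y := by
  simp [rowInsert, h]

lemma newBoxRow_cons_of_none {R : List ℕ} {x : ℕ} (T : List (List ℕ)) (h : (bump R x).2 = none) :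
    newBoxRow (R :: T) x = 0 := by
  simp [newBoxRow, h]

lemma newBoxRow_cons_of_some {R : List ℕ} {x y : ℕ} (T : List (List ℕ))
    (h : (bump R x).2 = some y) : newBoxRow (R :: T) x = newBoxRow T y + 1 := by
  simp [newBoxRow, h]

lemma rowInsert_headD (T : List (List ℕ)) (x : ℕ) :
    (rowInsert T x).headD [] = (bump (T.headD []) x).1 := by
  cases T with
  | nil => rfl
  | cons R T =>
    rcases h : (bump R x).2 with _ | y
    · rw [rowInsert_cons_of_none T h, List.headD_cons, List.headD_cons, bump_eq_append_of_none h]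
    · rw [rowInsert_cons_of_some T h, List.headD_cons, List.headD_cons]

lemma IsSemistandard.rowInsert {T : List (List ℕ)} (hT : IsSemistandard T) (x : ℕ) :
    IsSemistandard (rowInsert T x) := by
  induction T generalizing x with
  | nil => simp [PlanarMatching.rowInsert, IsSemistandard]
  | cons R T ih =>
    obtain ⟨hne, hR, hd, hT⟩ := hT
    rcases h : (bump R x).2 with _ | y
    · rw [rowInsert_cons_of_none T h]
      refine ⟨by simp, ?_, hd.append_left _, hT⟩
      rw [← bump_eq_append_of_none h]
      exact bump_sorted hR x
    · rw [rowInsert_cons_of_some T h]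
      refine ⟨bump_ne_nil R x, bump_sorted hR x, ?_, ih hT y⟩
      rw [rowInsert_headD]
      exact hd.bump_bump hR h

/-- The effect on the row lengths of creating a box at the end of row `k`. -/
def addBox : List ℕ → ℕ → List ℕ
  | [], _ => [1]
  | a :: l, 0 => (a + 1) :: l
  | a :: l, k + 1 => a :: addBox l k

lemma shape_rowInsert (T : List (List ℕ)) (x : ℕ) :
    shape (rowInsert T x) = addBox (shape T) (newBoxRow T x) := by
  induction T generalizing x with
  | nil => rfl
  | cons R T ih =>
    rcases h : (bump R x).2 with _ | y
    · rw [rowInsert_cons_of_none T h, newBoxRow_cons_of_none T h]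
      simp [shape, addBox]
    · rw [rowInsert_cons_of_some T h, newBoxRow_cons_of_some T h]
      have hl := (bump_perm_of_some h).length_eq
      simp only [List.length_cons, List.length_append, List.length_nil] at hl
      have ih := ih y
      simp only [shape] at ih
      simp only [shape, List.map_cons, addBox, ih, List.cons.injEq, and_true]
      omega

lemma shape_placeAt (T : List (List ℕ)) (k a : ℕ) :
    shape (placeAt T k a) = addBox (shape T) k := by
  induction T generalizing k with
  | nil => rfl
  | cons R T ih =>
    cases k with
    | zero => simp [placeAt, shape, addBox]
    | succ k => simpa [placeAt, shape, addBox] using ih k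

lemma newBoxRow_le (T : List (List ℕ)) (x : ℕ) : newBoxRow T x ≤ T.length := by
  induction T generalizing x with
  | nil => simp [newBoxRow]
  | cons R T ih =>
    rcases h : (bump R x).2 with _ | y
    · simp [newBoxRow_cons_of_none T h]
    · simpa [newBoxRow_cons_of_some T h] using ih y

lemma rowInsert_flatten_perm (T : List (List ℕ)) (x : ℕ) :
    (rowInsert T x).flatten.Perm (x :: T.flatten) := by
  induction T generalizing x with
  | nil => simp [rowInsert]
  | cons R T ih =>
    rcases h : (bump R x).2 with _ | y
    · rw [rowInsert_cons_of_none T h]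
      simp
    · rw [rowInsert_cons_of_some T h, List.flatten_cons, List.flatten_cons]
      calc ((bump R x).1 ++ (rowInsert T y).flatten).Perm ((bump R x).1 ++ (y :: T.flatten)) :=
            (ih y).append_left _
        _ |>.Perm (y :: ((bump R x).1 ++ T.flatten)) := List.perm_middle
        _ |>.Perm ((R ++ [x]) ++ T.flatten) := by
            simpa using (bump_perm_of_some h).append_right T.flatten
        _ |>.Perm (x :: (R ++ T.flatten)) := by simp

/-- Row bumping lemma: a smaller entry creates its box in a lower row. -/
lemma newBoxRow_lt_of_lt (T : List (List ℕ)) {x x' : ℕ} (h : x' < x) :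
    newBoxRow T x < newBoxRow (rowInsert T x) x' := by
  induction T generalizing x x' with
  | nil => simp [rowInsert, newBoxRow, bump, h]
  | cons R T ih =>
    have key : ∃ y', (bump (bump R x).1 x').2 = some y' ∧ y' ≤ x := by
      clear ih
      induction R with
      | nil => exact ⟨x, by simp [bump, h], le_rfl⟩
      | cons a R ih =>
        by_cases hx : x < a
        · rw [bump_cons_of_lt R hx, bump_cons_of_lt R h]
          exact ⟨x, rfl, le_rfl⟩
        · rw [bump_cons_of_not_lt R hx]
          by_cases hx' : x' < a
          · rw [bump_cons_of_lt _ hx']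
            exact ⟨a, rfl, not_lt.1 hx⟩
          · rw [bump_cons_of_not_lt _ hx']
            exact ih
    obtain ⟨y', hy', hle⟩ := key
    rcases hb : (bump R x).2 with _ | y
    · rw [rowInsert_cons_of_none T hb, newBoxRow_cons_of_none T hb,
        newBoxRow_cons_of_some T (by rwa [← bump_eq_append_of_none hb])]
      omega
    · rw [rowInsert_cons_of_some T hb, newBoxRow_cons_of_some T hb,
        newBoxRow_cons_of_some _ hy']
      have := ih (hle.trans_lt (lt_of_bump_eq_some hb))
      omega

/-- Row bumping lemma: an entry that is not smaller creates its box in the same row or a higher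
one. -/
lemma newBoxRow_le_of_le {T : List (List ℕ)} (hT : IsSemistandard T) {x x' : ℕ} (h : x ≤ x') :
    newBoxRow (rowInsert T x) x' ≤ newBoxRow T x := by
  induction T generalizing x x' with
  | nil => simp [rowInsert, newBoxRow, bump, h.not_gt]
  | cons R T ih =>
    obtain ⟨-, hR, -, hT⟩ := hT
    rcases hb : (bump R x).2 with _ | y
    · rw [rowInsert_cons_of_none T hb, newBoxRow_cons_of_none T hb, newBoxRow_cons_of_none]
      apply bump_eq_none_of_le
      intro a ha
      rcases List.mem_append.1 ha with ha | ha
      · exact (le_of_bump_eq_none hb a ha).trans h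
      · simp only [List.mem_singleton] at ha
        omega
    · rw [rowInsert_cons_of_some T hb, newBoxRow_cons_of_some T hb]
      rcases hb' : (bump (bump R x).1 x').2 with _ | y'
      · rw [newBoxRow_cons_of_none _ hb']
        omega
      · rw [newBoxRow_cons_of_some _ hb']
        have hyy : y ≤ y' := by
          clear ih
          induction R with
          | nil => simp [bump] at hb
          | cons a R ih =>
            rw [List.pairwise_cons] at hR
            by_cases hx : x < a
            · rw [bump_cons_of_lt R hx] at hb hb'
              rw [bump_cons_of_not_lt R h.not_gt] at hb'
              simp only [Option.some.injEq] at hb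
              subst hb
              exact hR.1 _ (mem_of_bump_eq_some hb')
            · rw [bump_cons_of_not_lt R hx] at hb hb'
              rw [bump_cons_of_not_lt _ (by omega)] at hb'
              exact ih hR.2 hb hb'
        have := ih hT hyy
        omega

lemma rowInsert_injective {T T' : List (List ℕ)} (hT : IsSemistandard T) (hT' : IsSemistandard T')
    {x x' : ℕ} (h : rowInsert T x = rowInsert T' x') (hk : newBoxRow T x = newBoxRow T' x') :
    T = T' ∧ x = x' := by
  induction T generalizing T' x x' with
  | nil =>
    cases T' with
    | nil => simpa [rowInsert] using h
    | cons R' T' =>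
      rcases hb' : (bump R' x').2 with _ | y'
      · rw [rowInsert_cons_of_none T' hb'] at h
        have := hT'.1
        rcases R' with _ | ⟨a, _ | ⟨b, R'⟩⟩ <;> simp_all [rowInsert]
      · rw [newBoxRow_cons_of_some T' hb'] at hk
        simp [newBoxRow] at hk
  | cons R T ih =>
    cases T' with
    | nil =>
      rcases hb : (bump R x).2 with _ | y
      · rw [rowInsert_cons_of_none T hb] at h
        have := hT.1
        rcases R with _ | ⟨a, _ | ⟨b, R⟩⟩ <;> simp_all [rowInsert]
      · rw [newBoxRow_cons_of_some T hb] at hk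
        simp [newBoxRow] at hk
    | cons R' T' =>
      obtain ⟨-, hR, -, hT⟩ := hT
      obtain ⟨-, hR', -, hT'⟩ := hT'
      rcases hb : (bump R x).2 with _ | y <;> rcases hb' : (bump R' x').2 with _ | y'
      · rw [rowInsert_cons_of_none T hb, rowInsert_cons_of_none T' hb'] at h
        simp only [List.cons.injEq] at h
        have := List.append_inj' h.1 rfl
        simp_all
      · rw [newBoxRow_cons_of_none T hb, newBoxRow_cons_of_some T' hb'] at hk
        omega
      · rw [newBoxRow_cons_of_some T hb, newBoxRow_cons_of_none T' hb'] at hk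
        omega
      · rw [newBoxRow_cons_of_some T hb, newBoxRow_cons_of_some T' hb', add_left_inj] at hk
        rw [rowInsert_cons_of_some T hb, rowInsert_cons_of_some T' hb'] at h
        simp only [List.cons.injEq] at h
        obtain ⟨rfl, rfl⟩ := ih hT hT' h.2 hk
        have h₁ := unbump_bump hR hb
        rw [h.1, unbump_bump hR' hb', Prod.mk.injEq] at h₁
        exact ⟨by rw [h₁.1], h₁.2.symm⟩

/-- Row insertion can be undone from any corner of the shape: reverse bumping passes the entry of
that corner upwards. The last clause is what the induction needs to continue with one more row on
top. -/
lemma exists_rowInsert_eq {P : List (List ℕ)} {l : List ℕ} {k : ℕ} (hP : IsSemistandard P)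
    (hk : k ≤ l.length) (hl : l.Pairwise (· ≥ ·)) (hpos : ∀ a ∈ l, a ≠ 0)
    (hs : shape P = addBox l k) :
    ∃ P₀ x, IsSemistandard P₀ ∧ shape P₀ = l ∧ rowInsert P₀ x = P ∧ newBoxRow P₀ x = k ∧
      ∀ R, Dominates (· < ·) R (P.headD []) →
        R.headD x < x ∧ Dominates (· < ·) (unbump R x).1 (P₀.headD []) := by
  induction P generalizing k l with
  | nil =>
    exfalso
    cases l with
    | nil => simp [shape, addBox] at hs
    | cons a l => cases k <;> simp [shape, addBox] at hs
  | cons R T ih =>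
    obtain ⟨hne, hR, hd, hT⟩ := hP
    obtain ⟨R₀, x, rfl⟩ : ∃ R₀ x, R = R₀ ++ [x] :=
      ⟨R.dropLast, R.getLast hne, (List.dropLast_append_getLast hne).symm⟩
    have last : ∀ R', Dominates (· < ·) R' (R₀ ++ [x]) →
        R'.headD x < x ∧ Dominates (· < ·) (unbump R' x).1 R₀ := fun R' h =>
      ⟨h.headD_lt (headD_append_singleton_le hR) (by simp), h.unbump_last hR⟩
    cases l with
    | nil =>
      have hk : k = 0 := by simpa using hk
      subst hk
      simp only [shape, addBox, List.map_cons, List.length_append, List.length_singleton,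
        List.cons.injEq, Nat.add_eq_right, List.length_eq_zero_iff, List.map_eq_nil_iff] at hs
      obtain ⟨rfl, rfl⟩ := hs
      exact ⟨[], x, trivial, rfl, rfl, rfl, last⟩
    | cons a l =>
      rw [List.pairwise_cons] at hl
      cases k with
      | zero =>
        simp only [shape, addBox, List.map_cons, List.length_append, List.length_singleton,
          List.cons.injEq, add_left_inj] at hs
        have hnone : (bump R₀ x).2 = none := by
          apply bump_eq_none_of_le
          intro b hb
          exact (List.pairwise_append.1 hR).2.2 b hb x (by simp)
        refine ⟨R₀ :: T, x, ⟨?_, ?_, ?_, hT⟩, ?_, rowInsert_cons_of_none T hnone,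
          newBoxRow_cons_of_none T hnone, last⟩
        · rintro rfl
          exact hpos a (by simp) (by simpa using hs.1.symm)
        · exact (List.pairwise_append.1 hR).1
        · apply hd.of_append_left
          cases T with
          | nil => simp
          | cons S T =>
            rw [List.headD_cons, hs.1]
            apply hl.1
            rw [← hs.2]
            simp
        · simp [shape, hs.1, ← hs.2]
      | succ k =>
        simp only [shape, addBox, List.map_cons, List.cons.injEq] at hs
        obtain ⟨T₀, y, hT₀, hsT, hins, hbox, hup⟩ := ih hT (by simpa using hk) hl.2
          (fun b hb => hpos b (by simp [hb])) hs.2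
        generalize R₀ ++ [x] = R at *
        obtain ⟨hlt, hdom⟩ := hup R hd
        have hbump := bump_unbump hR hlt
        have hsome : (bump (unbump R y).1 (unbump R y).2).2 = some y := by rw [hbump]
        refine ⟨(unbump R y).1 :: T₀, (unbump R y).2, ⟨?_, unbump_sorted hR hlt, hdom, hT₀⟩, ?_,
          ?_, ?_, fun R' hR' => ?_⟩
        · intro h0
          have := unbump_length R y
          rw [h0, eq_comm, List.length_nil, List.length_eq_zero_iff] at this
          exact hne this
        · simp only [shape] at hsT
          simp [shape, unbump_length, hs.1, hsT]
        · rw [rowInsert_cons_of_some T₀ hsome, hbump, hins]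
        · rw [newBoxRow_cons_of_some T₀ hsome, hbox]
        · refine ⟨hR'.headD_lt ?_ hne, hR'.unbump_unbump hR hlt⟩
          have hm := unbump_mem hlt
          cases R with
          | nil => exact absurd rfl hne
          | cons c R =>
            rw [List.headD_cons, List.headD_cons]
            rcases List.mem_cons.1 hm with hm | hm
            · exact hm.ge
            · exact (List.pairwise_cons.1 hR).1 _ hm

/-! ### The correspondence for words -/

lemma Dominates.trans {R S W : List ℕ} (h₁ : Dominates (· < ·) R S) (h₂ : Dominates (· < ·) S W) :
    Dominates (· < ·) R W := by
  rw [dominates_iff] at *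
  refine ⟨h₂.1.trans h₁.1, fun j h h' => ?_⟩
  exact (h₁.2 j h (h'.trans_le h₂.1)).trans (h₂.2 j _ h')

lemma IsSemistandard.pairwise_dominates {T : List (List ℕ)} (hT : IsSemistandard T) :
    T.Pairwise (Dominates (· < ·)) := by
  induction T with
  | nil => exact List.Pairwise.nil
  | cons R T ih =>
    obtain ⟨-, -, hd, hT⟩ := hT
    refine List.pairwise_cons.2 ⟨fun S hS => ?_, ih hT⟩
    cases T with
    | nil => simp at hS
    | cons W T =>
      rcases List.mem_cons.1 hS with rfl | hS
      · exact hd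
      · exact hd.trans ((List.pairwise_cons.1 (ih hT)).1 S hS)

lemma IsSemistandard.rows {T : List (List ℕ)} (hT : IsSemistandard T) :
    ∀ R ∈ T, R ≠ [] ∧ R.Pairwise (· ≤ ·) := by
  induction T with
  | nil => simp
  | cons R T ih =>
    obtain ⟨hne, hR, -, hT⟩ := hT
    simpa [hne, hR] using ih hT

lemma IsSemistandard.shape_pairwise {T : List (List ℕ)} (hT : IsSemistandard T) :
    (shape T).Pairwise (· ≥ ·) := by
  rw [shape, List.pairwise_map]
  exact hT.pairwise_dominates.imp fun h => ((dominates_iff _ _ _).1 h).1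

lemma IsSemistandard.shape_ne_zero {T : List (List ℕ)} (hT : IsSemistandard T) :
    ∀ a ∈ shape T, a ≠ 0 := by
  intro a ha
  obtain ⟨R, hR, rfl⟩ := List.mem_map.1 ha
  simpa using (hT.rows R hR).1

/-- A standard tableau is a semistandard one with distinct entries. -/
lemma isYoungTableau_iff (T : List (List ℕ)) :
    IsYoungTableau T ↔ IsSemistandard T ∧ T.flatten.Nodup := by
  constructor
  · rintro ⟨hne, hsh, hnd, hrow, hcol⟩
    refine ⟨?_, hnd⟩
    clear hnd
    induction T with
    | nil => trivial
    | cons R T ih =>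
      rw [List.pairwise_cons] at hcol
      simp only [shape, List.map_cons, List.pairwise_cons] at hsh
      refine ⟨hne R (by simp), (hrow R (by simp)).imp le_of_lt, ?_,
        ih (fun S hS => hne S (by simp [hS])) hsh.2 (fun S hS => hrow S (by simp [hS])) hcol.2⟩
      cases T with
      | nil => simp
      | cons S T =>
        rw [List.headD_cons, dominates_iff]
        exact ⟨hsh.1 _ (by simp), hcol.1 S (by simp)⟩
  · rintro ⟨hT, hnd⟩
    refine ⟨fun R hR => (hT.rows R hR).1, hT.shape_pairwise, hnd, fun R hR => ?_,
      hT.pairwise_dominates.imp fun h => ((dominates_iff _ _ _).1 h).2⟩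
    have h₁ : R.Nodup := (List.nodup_flatten.1 hnd).1 R hR
    exact (hT.rows R hR).2.imp₂ (fun a b hab hne => lt_of_le_of_ne hab hne) h₁

lemma placeAt_flatten_perm (T : List (List ℕ)) (k a : ℕ) :
    (placeAt T k a).flatten.Perm (a :: T.flatten) := by
  induction T generalizing k with
  | nil => simp [placeAt]
  | cons R T ih =>
    cases k with
    | zero => simp [placeAt]
    | succ k =>
      rw [placeAt, List.flatten_cons, List.flatten_cons]
      exact ((ih k).append_left R).trans List.perm_middle

lemma IsSemistandard.placeAt {Q : List (List ℕ)} (hQ : IsSemistandard Q) {k m : ℕ}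
    (hm : ∀ a ∈ Q.flatten, a < m) (hs : (addBox (shape Q) k).Pairwise (· ≥ ·)) :
    IsSemistandard (placeAt Q k m) := by
  induction Q generalizing k with
  | nil => simp [PlanarMatching.placeAt, IsSemistandard]
  | cons R T ih =>
    obtain ⟨hne, hR, hd, hT⟩ := hQ
    simp only [List.flatten_cons, List.mem_append] at hm
    cases k with
    | zero =>
      refine ⟨by simp, ?_, hd.append_left _, hT⟩
      rw [List.pairwise_append]
      refine ⟨hR, by simp, fun a ha b hb => ?_⟩
      rw [List.mem_singleton.1 hb]
      exact (hm a (Or.inl ha)).le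
    | succ k =>
      simp only [shape, List.map_cons, addBox, List.pairwise_cons] at hs
      refine ⟨hne, hR, ?_, ih hT (fun a ha => hm a (Or.inr ha)) hs.2⟩
      cases T with
      | nil =>
        cases R with
        | nil => exact absurd rfl hne
        | cons a R => exact ⟨hm a (by simp), by simp⟩
      | cons S T =>
        cases k with
        | zero =>
          refine hd.append_right ?_ fun a ha => hm a (Or.inl ha)
          simpa [addBox] using hs.1 (S.length + 1) (by simp [addBox])
        | succ k => exact hd

lemma placeAt_injective {Q Q' : List (List ℕ)} (hQ : IsSemistandard Q) (hQ' : IsSemistandard Q')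
    {k k' m : ℕ} (hm : m ∉ Q.flatten) (hm' : m ∉ Q'.flatten) (hk : k ≤ Q.length)
    (hk' : k' ≤ Q'.length) (h : placeAt Q k m = placeAt Q' k' m) : Q = Q' ∧ k = k' := by
  induction Q generalizing Q' k k' with
  | nil =>
    have hk : k = 0 := by simpa using hk
    subst hk
    cases Q' with
    | nil => simpa [eq_comm] using hk'
    | cons R' T' =>
      exfalso
      have hne := hQ'.1
      cases k' with
      | zero => rcases R' with _ | ⟨a, _ | ⟨b, R⟩⟩ <;> simp_all [placeAt]
      | succ k' =>
        simp only [placeAt, List.cons.injEq] at h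
        exact hm' (by simp [← h.1])
  | cons R T ih =>
    obtain ⟨hne, -, -, hT⟩ := hQ
    simp only [List.flatten_cons, List.mem_append, not_or] at hm
    cases Q' with
    | nil =>
      exfalso
      have hk' : k' = 0 := by simpa using hk'
      subst hk'
      cases k with
      | zero => rcases R with _ | ⟨a, _ | ⟨b, R⟩⟩ <;> simp_all [placeAt]
      | succ k => simp_all [placeAt]
    | cons R' T' =>
      obtain ⟨hne', -, -, hT'⟩ := hQ'
      simp only [List.flatten_cons, List.mem_append, not_or] at hm'
      cases k with
      | zero =>
        cases k' with
        | zero =>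
          simp only [placeAt, List.cons.injEq, List.append_cancel_right_eq] at h
          simp [h.1, h.2]
        | succ k' =>
          simp only [placeAt, List.cons.injEq] at h
          exact absurd (by simp [← h.1]) hm'.1
      | succ k =>
        cases k' with
        | zero =>
          simp only [placeAt, List.cons.injEq] at h
          exact absurd (by simp [h.1]) hm.1
        | succ k' =>
          simp only [placeAt, List.cons.injEq] at h
          obtain ⟨rfl, rfl⟩ :=
            ih hT hT' hm.2 hm'.2 (by simpa using hk) (by simpa using hk') h.2
          exact ⟨by rw [h.1], rfl⟩

/-- The largest entry of a tableau with distinct entries occupies a corner. -/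
lemma exists_placeAt_eq {Q : List (List ℕ)} {m : ℕ} (hQ : IsSemistandard Q)
    (hnd : Q.flatten.Nodup) (hmem : m ∈ Q.flatten) (hmax : ∀ a ∈ Q.flatten, a ≤ m) :
    ∃ Q₀ k, k ≤ Q₀.length ∧ IsSemistandard Q₀ ∧ placeAt Q₀ k m = Q := by
  induction Q with
  | nil => simp at hmem
  | cons R T ih =>
    obtain ⟨hne, hR, hd, hT⟩ := hQ
    simp only [List.flatten_cons, List.mem_append] at hmem hmax
    rw [List.flatten_cons, List.nodup_append] at hnd
    by_cases hmR : m ∈ R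
    · obtain ⟨R₀, x, rfl⟩ : ∃ R₀ x, R = R₀ ++ [x] :=
        ⟨R.dropLast, R.getLast hne, (List.dropLast_append_getLast hne).symm⟩
      rw [List.pairwise_append] at hR
      have hx : x = m := by
        rcases List.mem_append.1 hmR with h | h
        · exact le_antisymm (hmax x (by simp)) (hR.2.2 m h x (by simp))
        · exact (List.mem_singleton.1 h).symm
      subst hx
      have hlen : (T.headD []).length ≤ R₀.length := by
        by_contra hlt
        rw [not_le] at hlt
        have h₁ := ((dominates_iff _ _ _).1 hd).2 R₀.length (by simp) hlt
        rw [List.getElem_concat_length rfl] at h₁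
        refine absurd h₁ (not_lt.2 (hmax _ (Or.inr ?_)))
        cases T with
        | nil => simp at hlt
        | cons S T => exact List.mem_append.2 (Or.inl (List.getElem_mem _))
      by_cases hR₀ : R₀ = []
      · subst hR₀
        refine ⟨[], 0, le_rfl, trivial, ?_⟩
        cases T with
        | nil => rfl
        | cons S T => exact absurd (by simpa using hlen) hT.1
      · exact ⟨R₀ :: T, 0, by simp, ⟨hR₀, hR.1, hd.of_append_left hlen, hT⟩, rfl⟩
    · obtain ⟨T₀, k, hk, hT₀, rfl⟩ :=
        ih hT hnd.2.1 (hmem.resolve_left hmR) fun a ha => hmax a (Or.inr ha)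
      refine ⟨R :: T₀, k + 1, by simpa using hk, ⟨hne, hR, ?_, hT₀⟩, rfl⟩
      cases T₀ with
      | nil => simp
      | cons S T₀ =>
        cases k with
        | zero => exact Dominates.of_append_right hd
        | succ k => exact hd

/-- The pair of tableaux of a word: its letters are inserted one by one, and the boxes are
numbered from `1` in the order of their creation. -/
def rskWord (w : List ℕ) : List (List ℕ) × List (List ℕ) :=
  (w.zipIdx 1).foldl rskStep ([], [])

lemma rskWord_append_singleton (w : List ℕ) (x : ℕ) :
    rskWord (w ++ [x]) = (rowInsert (rskWord w).1 x,
      placeAt (rskWord w).2 (newBoxRow (rskWord w).1 x) (w.length + 1)) := by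
  simp [rskWord, List.zipIdx_append, rskStep, add_comm]

lemma rskWord_spec (w : List ℕ) :
    IsSemistandard (rskWord w).1 ∧ IsSemistandard (rskWord w).2 ∧
      shape (rskWord w).1 = shape (rskWord w).2 ∧ (rskWord w).1.flatten.Perm w ∧
      (rskWord w).2.flatten.Perm (List.range' 1 w.length) := by
  induction w using List.reverseRecOn with
  | nil => simp [rskWord, IsSemistandard]
  | append_singleton w x ih =>
    obtain ⟨hP, hQ, hs, hpP, hpQ⟩ := ih
    rw [rskWord_append_singleton]
    have hs' : shape (rowInsert (rskWord w).1 x) =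
        addBox (shape (rskWord w).2) (newBoxRow (rskWord w).1 x) := by
      rw [shape_rowInsert, hs]
    refine ⟨hP.rowInsert x, hQ.placeAt (fun a ha => ?_) ?_, ?_, ?_, ?_⟩
    · have := hpQ.mem_iff.1 ha
      rw [List.mem_range'_1] at this
      omega
    · rw [← hs']
      exact (hP.rowInsert x).shape_pairwise
    · rw [hs', shape_placeAt]
    · exact (rowInsert_flatten_perm _ x).trans
        ((hpP.cons x).trans (List.perm_append_singleton x w).symm)
    · rw [List.length_append, List.length_singleton, List.range'_1_concat, add_comm 1]
      exact (placeAt_flatten_perm _ _ _).trans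
        ((hpQ.cons _).trans (List.perm_append_singleton _ _).symm)

lemma length_add_one_notMem_rskWord (w : List ℕ) : w.length + 1 ∉ (rskWord w).2.flatten := by
  rw [(rskWord_spec w).2.2.2.2.mem_iff, List.mem_range'_1]
  omega

lemma newBoxRow_rskWord_le (w : List ℕ) (x : ℕ) :
    newBoxRow (rskWord w).1 x ≤ (rskWord w).2.length := by
  have h := congrArg List.length (rskWord_spec w).2.2.1
  simp only [shape, List.length_map] at h
  rw [← h]
  exact newBoxRow_le _ x

lemma rskWord_injective : Function.Injective rskWord := by
  intro w w' h
  have hl : w.length = w'.length := by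
    have h₁ := (rskWord_spec w).2.2.2.1.length_eq
    rw [h, (rskWord_spec w').2.2.2.1.length_eq] at h₁
    exact h₁.symm
  induction w using List.reverseRecOn generalizing w' with
  | nil => exact (List.length_eq_zero_iff.1 hl.symm).symm
  | append_singleton w x ih =>
    rcases List.eq_nil_or_concat w' with rfl | ⟨w', x', rfl⟩
    · simp at hl
    · rw [List.concat_eq_append] at h hl ⊢
      have hl' : w.length = w'.length := by simpa using hl
      rw [rskWord_append_singleton, rskWord_append_singleton, Prod.mk.injEq, hl'] at h
      obtain ⟨hP, hQ, -⟩ := rskWord_spec w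
      obtain ⟨hP', hQ', -⟩ := rskWord_spec w'
      obtain ⟨h₂, hk⟩ := placeAt_injective hQ hQ' (hl' ▸ length_add_one_notMem_rskWord w)
        (length_add_one_notMem_rskWord w') (newBoxRow_rskWord_le w x)
        (newBoxRow_rskWord_le w' x') h.2
      obtain ⟨h₁, rfl⟩ := rowInsert_injective hP hP' h.1 hk
      rw [ih (Prod.ext h₁ h₂) hl']

lemma exists_rskWord_eq {m : ℕ} {P Q : List (List ℕ)} (hP : IsSemistandard P)
    (hQ : IsSemistandard Q) (hs : shape P = shape Q) (hpQ : Q.flatten.Perm (List.range' 1 m)) :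
    ∃ w : List ℕ, w.length = m ∧ rskWord w = (P, Q) := by
  induction m generalizing P Q with
  | zero =>
    have hQ0 : Q = [] := by
      cases Q with
      | nil => rfl
      | cons R T => exact absurd (by simp_all) hQ.1
    subst hQ0
    have hP0 : P = [] := by simpa [shape] using hs
    exact ⟨[], rfl, by rw [hP0]; rfl⟩
  | succ m ih =>
    have hnd : Q.flatten.Nodup := hpQ.nodup_iff.2 (List.nodup_range' ..)
    obtain ⟨Q₀, k, hk, hQ₀, rfl⟩ := exists_placeAt_eq (m := m + 1) hQ hnd
      (by rw [hpQ.mem_iff, List.mem_range'_1]; omega)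
      (fun a ha => by rw [hpQ.mem_iff, List.mem_range'_1] at ha; omega)
    rw [shape_placeAt] at hs
    obtain ⟨P₀, x, hP₀, hs₀, rfl, rfl, -⟩ := exists_rowInsert_eq hP (by simpa [shape] using hk)
      hQ₀.shape_pairwise hQ₀.shape_ne_zero hs
    have hpQ₀ : Q₀.flatten.Perm (List.range' 1 m) := by
      rw [List.range'_1_concat, add_comm 1] at hpQ
      exact (List.perm_cons (m + 1)).1 (((placeAt_flatten_perm _ _ _).symm.trans hpQ).trans
        (List.perm_append_singleton _ _))
    obtain ⟨w, rfl, hw⟩ := ih hP₀ hQ₀ hs₀ hpQ₀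
    exact ⟨w ++ [x], by simp, by rw [rskWord_append_singleton, hw]⟩

/-! ### Descents -/

lemma inRow_cons_zero (R : List ℕ) (T : List (List ℕ)) (x : ℕ) :
    InRow (R :: T) 0 x ↔ x ∈ R := by
  simp [InRow]

lemma inRow_cons_succ (R : List ℕ) (T : List (List ℕ)) (k x : ℕ) :
    InRow (R :: T) (k + 1) x ↔ InRow T k x := by
  simp [InRow]

lemma InRow.placeAt {T : List (List ℕ)} {k x : ℕ} (h : InRow T k x) (k' a : ℕ) :
    InRow (placeAt T k' a) k x := by
  induction T generalizing k k' with
  | nil => simp [InRow] at h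
  | cons R T ih =>
    cases k with
    | zero =>
      rw [inRow_cons_zero] at h
      cases k' <;> simp [PlanarMatching.placeAt, inRow_cons_zero, h]
    | succ k =>
      rw [inRow_cons_succ] at h
      cases k' with
      | zero => simpa [PlanarMatching.placeAt, inRow_cons_succ] using h
      | succ k' => simpa [PlanarMatching.placeAt, inRow_cons_succ] using ih h k'

lemma inRow_placeAt_self {T : List (List ℕ)} {k : ℕ} (hk : k ≤ T.length) (a : ℕ) :
    InRow (placeAt T k a) k a := by
  induction T generalizing k with
  | nil =>
    have hk : k = 0 := by simpa using hk
    subst hk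
    simp [placeAt, InRow]
  | cons R T ih =>
    cases k with
    | zero => simp [placeAt, inRow_cons_zero]
    | succ k => simpa [placeAt, inRow_cons_succ] using ih (by simpa using hk)

lemma InRow.mem_flatten {T : List (List ℕ)} {k x : ℕ} (h : InRow T k x) : x ∈ T.flatten := by
  obtain ⟨R, hR, hx⟩ := h
  exact List.mem_flatten.2 ⟨R, List.mem_of_getElem? hR, hx⟩

lemma InRow.unique {T : List (List ℕ)} (hT : T.flatten.Nodup) {k l x : ℕ} (hk : InRow T k x)
    (hl : InRow T l x) : k = l := by
  induction T generalizing k l with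
  | nil => simp [InRow] at hk
  | cons R T ih =>
    rw [List.flatten_cons, List.nodup_append] at hT
    cases k with
    | zero =>
      cases l with
      | zero => rfl
      | succ l =>
        rw [inRow_cons_zero] at hk
        rw [inRow_cons_succ] at hl
        exact absurd rfl (hT.2.2 x hk x hl.mem_flatten)
    | succ k =>
      rw [inRow_cons_succ] at hk
      cases l with
      | zero =>
        rw [inRow_cons_zero] at hl
        exact absurd rfl (hT.2.2 x hl x hk.mem_flatten)
      | succ l =>
        rw [inRow_cons_succ] at hl
        rw [ih hT.2.1 hk hl]

lemma InRow.rskWord_append {w : List ℕ} {k x : ℕ} (h : InRow (rskWord w).2 k x) (z : List ℕ) :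
    InRow (rskWord (w ++ z)).2 k x := by
  induction z using List.reverseRecOn with
  | nil => simpa using h
  | append_singleton z y ih =>
    rw [← List.append_assoc, rskWord_append_singleton]
    exact ih.placeAt _ _

/-- The descents of the recording tableau are those of the word. -/
lemma descent_recording_iff (w z : List ℕ) (x y : ℕ) :
    (∃ k l, InRow (rskWord (w ++ x :: y :: z)).2 k (w.length + 1) ∧
      InRow (rskWord (w ++ x :: y :: z)).2 l (w.length + 1 + 1) ∧ k < l) ↔ y < x := by
  have hnd : (rskWord (w ++ x :: y :: z)).2.flatten.Nodup :=
    (rskWord_spec _).2.2.2.2.nodup_iff.2 (List.nodup_range' ..)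
  have h₁ : InRow (rskWord (w ++ x :: y :: z)).2 (newBoxRow (rskWord w).1 x) (w.length + 1) := by
    have : InRow (rskWord (w ++ [x])).2 (newBoxRow (rskWord w).1 x) (w.length + 1) := by
      rw [rskWord_append_singleton]
      exact inRow_placeAt_self (newBoxRow_rskWord_le w x) _
    simpa using this.rskWord_append (y :: z)
  have h₂ : InRow (rskWord (w ++ x :: y :: z)).2 (newBoxRow (rowInsert (rskWord w).1 x) y)
      (w.length + 1 + 1) := by
    have : InRow (rskWord ((w ++ [x]) ++ [y])).2 (newBoxRow (rskWord (w ++ [x])).1 y)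
        ((w ++ [x]).length + 1) := by
      rw [rskWord_append_singleton (w ++ [x])]
      exact inRow_placeAt_self (newBoxRow_rskWord_le _ y) _
    rw [rskWord_append_singleton w] at this
    simpa using this.rskWord_append z
  constructor
  · rintro ⟨k, l, hk, hl, hkl⟩
    rw [hk.unique hnd h₁, hl.unique hnd h₂] at hkl
    by_contra hxy
    exact absurd (newBoxRow_le_of_le (rskWord_spec w).1 (not_lt.1 hxy)) hkl.not_ge
  · exact fun h => ⟨_, _, h₁, h₂, newBoxRow_lt_of_lt _ h⟩

/-- If `p < q`, then `q` lies below `p` in a tableau if and only if `q` precedes `p` in its reading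
word, in which the rows are listed from bottom to top. -/
lemma inRow_lt_iff_not_pairwise {T : List (List ℕ)} (hT : IsSemistandard T) {p q : ℕ}
    (hpq : p < q) :
    (∃ k l, InRow T k p ∧ InRow T l q ∧ k < l) ↔
      ¬ T.reverse.flatten.Pairwise (fun a b => ¬ (a = q ∧ b = p)) := by
  rw [List.pairwise_flatten, List.pairwise_reverse]
  have hrow : ∀ R ∈ T.reverse, R.Pairwise (fun a b => ¬ (a = q ∧ b = p)) := by
    intro R hR
    refine (hT.rows R (List.mem_reverse.1 hR)).2.imp fun {a b} hab => ?_
    omega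
  rw [and_iff_right hrow, List.pairwise_iff_getElem]
  constructor
  · rintro ⟨k, l, ⟨R, hR, hp⟩, ⟨S, hS, hq⟩, hkl⟩ h
    obtain ⟨hk, rfl⟩ := List.getElem?_eq_some_iff.1 hR
    obtain ⟨hl, rfl⟩ := List.getElem?_eq_some_iff.1 hS
    exact h k l hk hl hkl q hq p hp ⟨rfl, rfl⟩
  · intro h
    push Not at h
    obtain ⟨k, l, hk, hl, hkl, a, ha, b, hb, rfl, rfl⟩ := h
    exact ⟨k, l, ⟨_, List.getElem?_eq_getElem hk, hb⟩, ⟨_, List.getElem?_eq_getElem hl, ha⟩, hkl⟩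

/-- Bumping an entry out of a row never exchanges two consecutive values: an exchange of two
letters requires a third one of intermediate value. -/
lemma filter_bump {R : List ℕ} (hR : R.Pairwise (· < ·)) {x y : ℕ} (hx : x ∉ R)
    (h : (bump R x).2 = some y) (p : ℕ) :
    (R ++ [x]).filter (fun a => a = p ∨ a = p + 1) =
      (y :: (bump R x).1).filter (fun a => a = p ∨ a = p + 1) := by
  induction R with
  | nil => simp [bump] at h
  | cons a R ih =>
    rw [List.pairwise_cons] at hR
    simp only [List.mem_cons, not_or] at hx
    by_cases hxa : x < a
    · rw [bump_cons_of_lt R hxa] at h ⊢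
      obtain rfl : a = y := by simpa using h
      by_cases hp : x = p ∨ x = p + 1
      · have hnil : R.filter (fun a => a = p ∨ a = p + 1) = [] := by
          rw [List.filter_eq_nil_iff]
          intro b hb
          have := hR.1 b hb
          simp only [decide_eq_true_eq]
          omega
        simp only [List.filter_append, List.cons_append, List.filter_cons, hnil, hp]
        simp
      · simp [List.filter_cons, hp]
    · rw [bump_cons_of_not_lt R hxa] at h ⊢
      have hxy := lt_of_bump_eq_some h
      have ih := ih hR.2 hx.2 h
      rw [List.cons_append, List.filter_cons, ih]
      have hsep : ¬ ((a = p ∨ a = p + 1) ∧ (y = p ∨ y = p + 1)) := by omega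
      by_cases ha : a = p ∨ a = p + 1
      · have hy : ¬ (y = p ∨ y = p + 1) := fun hy => hsep ⟨ha, hy⟩
        simp [ha, hy]
      · simp [List.filter_cons, ha]

lemma filter_readingWord_rowInsert {T : List (List ℕ)} (hT : IsSemistandard T) {x : ℕ}
    (hnd : (x :: T.flatten).Nodup) (p : ℕ) :
    (rowInsert T x).reverse.flatten.filter (fun a => a = p ∨ a = p + 1) =
      (T.reverse.flatten ++ [x]).filter (fun a => a = p ∨ a = p + 1) := by
  induction T generalizing x with
  | nil => simp [rowInsert]
  | cons R T ih =>
    obtain ⟨-, hR, -, hT⟩ := hT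
    rcases h : (bump R x).2 with _ | y
    · rw [rowInsert_cons_of_none T h]
      simp
    · rw [List.nodup_cons, List.flatten_cons, List.nodup_append, List.mem_append, not_or] at hnd
      obtain ⟨⟨hxR, -⟩, hndR, hndT, hdisj⟩ := hnd
      have hy := mem_of_bump_eq_some h
      have ih := ih hT (x := y) (List.nodup_cons.2 ⟨fun h => hdisj y hy y h rfl, hndT⟩)
      have hlt : R.Pairwise (· < ·) := hR.imp₂ (fun a b => lt_of_le_of_ne) hndR
      have hb := filter_bump hlt hxR h p
      rw [rowInsert_cons_of_some T h]
      simp only [List.reverse_cons, List.flatten_append, List.flatten_cons, List.flatten_nil,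
        List.append_nil, List.append_assoc, List.filter_append] at ih hb ⊢
      rw [hb, ih, List.append_assoc, ← List.filter_append, List.singleton_append]

lemma filter_readingWord_rskWord {w : List ℕ} (hw : w.Nodup) (p : ℕ) :
    (rskWord w).1.reverse.flatten.filter (fun a => a = p ∨ a = p + 1) =
      w.filter (fun a => a = p ∨ a = p + 1) := by
  induction w using List.reverseRecOn with
  | nil => rfl
  | append_singleton w x ih =>
    have hw' : (x :: w).Nodup := (List.perm_append_singleton x w).nodup_iff.1 hw
    obtain ⟨hP, -, -, hperm, -⟩ := rskWord_spec w
    rw [rskWord_append_singleton]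
    dsimp only
    rw [filter_readingWord_rowInsert hP ((hperm.cons x).nodup_iff.2 hw'),
      List.filter_append, ih (List.nodup_cons.1 hw').2, List.filter_append]

/-- The descents of the insertion tableau are the values `p` such that `p + 1` precedes `p` in the
word. -/
lemma descent_insertion_iff {w : List ℕ} (hw : w.Nodup) (p : ℕ) :
    (∃ k l, InRow (rskWord w).1 k p ∧ InRow (rskWord w).1 l (p + 1) ∧ k < l) ↔
      ¬ w.Pairwise (fun a b => ¬ (a = p + 1 ∧ b = p)) := by
  have hfilter : ∀ l : List ℕ, l.Pairwise (fun a b => ¬ (a = p + 1 ∧ b = p)) ↔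
      (l.filter (fun a => a = p ∨ a = p + 1)).Pairwise (fun a b => ¬ (a = p + 1 ∧ b = p)) := by
    intro l
    rw [List.pairwise_filter]
    refine List.Pairwise.iff fun a b => ?_
    simp only [decide_eq_true_eq]
    tauto
  rw [inRow_lt_iff_not_pairwise (rskWord_spec w).1 p.lt_succ_self, hfilter,
    filter_readingWord_rskWord hw, ← hfilter]

/-! ### Increasing subsequences -/

lemma firstRow_append_singleton (w : List ℕ) (x : ℕ) :
    (rskWord (w ++ [x])).1.headD [] = (bump ((rskWord w).1.headD []) x).1 := by
  rw [rskWord_append_singleton, rowInsert_headD]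

lemma Dominates.bump_append {R s : List ℕ} {x : ℕ} (h : Dominates (· ≤ ·) R s)
    (hs : ∀ b ∈ s, b ≤ x) : Dominates (· ≤ ·) (PlanarMatching.bump R x).1 (s ++ [x]) := by
  induction R generalizing s with
  | nil => cases s <;> simp_all [PlanarMatching.bump]
  | cons a R ih =>
    cases s with
    | nil =>
      by_cases hx : x < a
      · simp [bump_cons_of_lt R hx]
      · simpa [bump_cons_of_not_lt R hx] using hx
    | cons b s =>
      have hbx := hs b (by simp)
      rw [bump_cons_of_not_lt R (not_lt.2 (h.1.trans hbx))]
      exact ⟨h.1, ih h.2 fun c hc => hs c (by simp [hc])⟩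

/-- The first row of the insertion tableau is a lower bound for every weakly increasing
subsequence of the word. -/
lemma dominates_firstRow {w s : List ℕ} (hsw : s.Sublist w) (hs : s.Pairwise (· ≤ ·)) :
    Dominates (· ≤ ·) ((rskWord w).1.headD []) s := by
  induction w using List.reverseRecOn generalizing s with
  | nil => simp [List.sublist_nil.1 hsw]
  | append_singleton w x ih =>
    rw [firstRow_append_singleton]
    obtain ⟨s₁, s₂, rfl, h₁, h₂⟩ := List.sublist_append_iff.1 hsw
    rw [List.pairwise_append] at hs
    rcases List.sublist_singleton.1 h₂ with rfl | rfl
    · rw [List.append_nil]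
      exact Dominates.bump (r := (· ≤ ·)) (fun h₁ h₂ => h₁.le.trans h₂) (ih h₁ hs.1) x
    · exact (ih h₁ hs.1).bump_append fun b hb => hs.2.2 b hb x (by simp)

lemma getElem?_bump {R : List ℕ} {x j e : ℕ} (h : (bump R x).1[j]? = some e) :
    R[j]? = some e ∨
      (e = x ∧ (j = 0 ∨ ∃ i f, j = i + 1 ∧ R[i]? = some f ∧ f ≤ x)) := by
  induction R generalizing j with
  | nil => cases j <;> simp_all [bump]
  | cons a R ih =>
    by_cases hx : x < a
    · rw [bump_cons_of_lt R hx] at h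
      cases j with
      | zero => exact Or.inr ⟨by simpa using h.symm, Or.inl rfl⟩
      | succ j => exact Or.inl (by simpa using h)
    · rw [bump_cons_of_not_lt R hx] at h
      cases j with
      | zero => exact Or.inl (by simpa using h)
      | succ j =>
        rcases ih (by simpa using h) with h | ⟨rfl, rfl | ⟨i, f, rfl, hf, hfx⟩⟩
        · exact Or.inl (by simpa using h)
        · exact Or.inr ⟨rfl, Or.inr ⟨0, a, rfl, by simp, not_lt.1 hx⟩⟩
        · exact Or.inr ⟨rfl, Or.inr ⟨i + 1, f, rfl, by simpa using hf, hfx⟩⟩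

/-- The entry of column `j` (counted from `0`) of the first row ends a weakly increasing
subsequence of length `j + 1` of the word. -/
lemma exists_sublist_of_firstRow {w : List ℕ} {j e : ℕ}
    (h : ((rskWord w).1.headD [])[j]? = some e) :
    ∃ s : List ℕ, (s ++ [e]).Sublist w ∧ (s ++ [e]).Pairwise (· ≤ ·) ∧ s.length = j := by
  induction w using List.reverseRecOn generalizing j e with
  | nil => simp [rskWord] at h
  | append_singleton w x ih =>
    rw [firstRow_append_singleton] at h
    rcases getElem?_bump h with h | ⟨rfl, rfl | ⟨i, f, rfl, hf, hfx⟩⟩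
    · obtain ⟨s, hs, hs'⟩ := ih h
      exact ⟨s, hs.trans (List.sublist_append_left _ _), hs'⟩
    · exact ⟨[], by simp, by simp, rfl⟩
    · obtain ⟨s, hs, hp, rfl⟩ := ih hf
      refine ⟨s ++ [f], hs.append (List.Sublist.refl _), ?_, by simp⟩
      refine List.pairwise_append.2 ⟨hp, by simp, fun a ha b hb => ?_⟩
      rw [List.mem_singleton.1 hb]
      rcases List.mem_append.1 ha with ha | ha
      · exact ((List.pairwise_append.1 hp).2.2 a ha f (by simp)).trans hfx
      · rwa [List.mem_singleton.1 ha]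

/-- Schensted's theorem: the number of columns is the largest length of a weakly increasing
subsequence. -/
lemma numColumns_rskWord_le_iff (w : List ℕ) (d : ℕ) :
    numColumns (rskWord w).1 ≤ d ↔
      ∀ s : List ℕ, s.Sublist w → s.Pairwise (· ≤ ·) → s.length ≤ d := by
  constructor
  · intro h s hsw hs
    exact ((dominates_iff _ _ _).1 (dominates_firstRow hsw hs)).1.trans h
  · intro h
    by_contra hd
    rw [not_le, numColumns] at hd
    obtain ⟨s, hs, hp, hl⟩ := exists_sublist_of_firstRow (List.getElem?_eq_getElem hd)
    have := h _ hs hp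
    simp only [List.length_append, List.length_singleton, hl] at this
    omega

/-! ### The correspondence for permutations -/

/-- The one-line notation of a permutation of `[m]`, with letters numbered from `1`. -/
def permWord {m : ℕ} (π : Equiv.Perm (Fin m)) : List ℕ := List.ofFn fun i => (π i : ℕ) + 1

lemma permWord_length {m : ℕ} (π : Equiv.Perm (Fin m)) : (permWord π).length = m := by
  simp [permWord]

lemma rskPerm_eq_rskWord {m : ℕ} (π : Equiv.Perm (Fin m)) : rskPerm π = rskWord (permWord π) := by
  have h : (List.ofFn fun i : Fin m => ((π i : ℕ) + 1, (i : ℕ) + 1)) = (permWord π).zipIdx 1 := by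
    apply List.ext_getElem
    · simp [permWord]
    · intro i h₁ h₂
      simp [permWord, add_comm]
  rw [rskPerm, rskWord, h]

lemma permWord_injective {m : ℕ} :
    Function.Injective (permWord : Equiv.Perm (Fin m) → List ℕ) := by
  intro π σ h
  have h := List.ofFn_injective h
  ext i
  simpa using congrFun h i

lemma permWord_nodup {m : ℕ} (π : Equiv.Perm (Fin m)) : (permWord π).Nodup := by
  rw [permWord, List.nodup_ofFn]
  intro i j h
  simpa [Fin.val_inj] using h

lemma permWord_toFinset {m : ℕ} (π : Equiv.Perm (Fin m)) :
    (permWord π).toFinset = Finset.Icc 1 m := by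
  ext a
  simp only [permWord, List.mem_toFinset, List.mem_ofFn, Finset.mem_Icc]
  constructor
  · rintro ⟨i, rfl⟩
    have := (π i).isLt
    omega
  · rintro ⟨h₁, h₂⟩
    refine ⟨π.symm ⟨a - 1, by omega⟩, ?_⟩
    simp only [Equiv.apply_symm_apply]
    omega

lemma exists_permWord_eq {m : ℕ} {w : List ℕ} (hl : w.length = m) (hnd : w.Nodup)
    (hw : w.toFinset = Finset.Icc 1 m) : ∃ π : Equiv.Perm (Fin m), permWord π = w := by
  subst hl
  have hmem : ∀ i : Fin w.length, 1 ≤ w[i] ∧ w[i] ≤ w.length := fun i => by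
    rw [← Finset.mem_Icc, ← hw, List.mem_toFinset]
    exact List.getElem_mem _
  let f : Fin w.length → Fin w.length := fun i => ⟨w[i] - 1, by have := hmem i; omega⟩
  have hf : Function.Injective f := by
    intro i j h
    have h : w[i] - 1 = w[j] - 1 := congrArg Fin.val h
    have hi := hmem i
    have hj := hmem j
    have hij : w[i] = w[j] := by omega
    exact Fin.ext ((hnd.getElem_inj_iff).1 hij)
  refine ⟨Equiv.ofBijective f (Finite.injective_iff_bijective.1 hf), ?_⟩
  apply List.ext_getElem
  · simp [permWord]
  · intro i h₁ h₂
    have := hmem ⟨i, h₂⟩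
    simp only [Fin.getElem_fin] at this
    simp only [permWord, List.getElem_ofFn, Equiv.ofBijective_apply, f, Fin.getElem_fin]
    omega

lemma rskPerm_injective {m : ℕ} :
    Function.Injective (rskPerm : Equiv.Perm (Fin m) → _) := by
  intro π σ h
  rw [rskPerm_eq_rskWord, rskPerm_eq_rskWord] at h
  exact permWord_injective (rskWord_injective h)

lemma rskPerm_spec {m : ℕ} (π : Equiv.Perm (Fin m)) :
    IsYoungTableau (rskPerm π).1 ∧ IsYoungTableau (rskPerm π).2 ∧
      (rskPerm π).1.flatten.toFinset = Finset.Icc 1 m ∧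
      (rskPerm π).2.flatten.toFinset = Finset.Icc 1 m ∧
      shape (rskPerm π).1 = shape (rskPerm π).2 := by
  rw [rskPerm_eq_rskWord]
  obtain ⟨hP, hQ, hs, hpP, hpQ⟩ := rskWord_spec (permWord π)
  refine ⟨(isYoungTableau_iff _).2 ⟨hP, hpP.nodup_iff.2 (permWord_nodup π)⟩,
    (isYoungTableau_iff _).2 ⟨hQ, hpQ.nodup_iff.2 (List.nodup_range' ..)⟩, ?_, ?_, hs⟩
  · rw [List.toFinset_eq_of_perm _ _ hpP, permWord_toFinset]
  · rw [List.toFinset_eq_of_perm _ _ hpQ, permWord_length]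
    ext a
    simp only [List.mem_toFinset, List.mem_range'_1, Finset.mem_Icc]
    omega

lemma exists_rskPerm_eq {m : ℕ} {P Q : List (List ℕ)} (hP : IsYoungTableau P)
    (hQ : IsYoungTableau Q) (heP : P.flatten.toFinset = Finset.Icc 1 m)
    (heQ : Q.flatten.toFinset = Finset.Icc 1 m) (hs : shape P = shape Q) :
    ∃ π : Equiv.Perm (Fin m), rskPerm π = (P, Q) := by
  rw [isYoungTableau_iff] at hP hQ
  have hpQ : Q.flatten.Perm (List.range' 1 m) := by
    rw [List.perm_ext_iff_of_nodup hQ.2 (List.nodup_range' ..)]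
    intro a
    rw [← List.mem_toFinset, heQ, Finset.mem_Icc, List.mem_range'_1]
    omega
  obtain ⟨w, hl, hw⟩ := exists_rskWord_eq hP.1 hQ.1 hs hpQ
  have hpP := (rskWord_spec w).2.2.2.1
  rw [hw] at hpP
  obtain ⟨π, rfl⟩ := exists_permWord_eq hl (hpP.nodup_iff.1 hP.2)
    (by rw [← List.toFinset_eq_of_perm _ _ hpP, heP])
  exact ⟨π, by rw [rskPerm_eq_rskWord, hw]⟩

lemma descent_snd_rskPerm_iff {m : ℕ} (π : Equiv.Perm (Fin m)) {i : ℕ} (hi : i + 1 < m) :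
    (∃ k l, InRow (rskPerm π).2 k (i + 1) ∧ InRow (rskPerm π).2 l (i + 1 + 1) ∧ k < l) ↔
      π ⟨i + 1, hi⟩ < π ⟨i, by omega⟩ := by
  have hl := permWord_length π
  have hw : permWord π = (permWord π).take i ++
      ((π ⟨i, by omega⟩ : ℕ) + 1) :: ((π ⟨i + 1, hi⟩ : ℕ) + 1) :: (permWord π).drop (i + 2) := by
    conv_lhs => rw [← List.take_append_drop i (permWord π)]
    rw [List.drop_eq_getElem_cons (by omega), List.drop_eq_getElem_cons (by omega)]
    simp [permWord]
  have hlt : ((permWord π).take i).length = i := by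
    rw [List.length_take]
    omega
  have h := descent_recording_iff ((permWord π).take i) ((permWord π).drop (i + 2))
    ((π ⟨i, by omega⟩ : ℕ) + 1) ((π ⟨i + 1, hi⟩ : ℕ) + 1)
  rw [← hw, hlt, ← rskPerm_eq_rskWord] at h
  rw [h, add_lt_add_iff_right, Fin.lt_def]

lemma descent_fst_rskPerm_iff {m : ℕ} (π : Equiv.Perm (Fin m)) {i : ℕ} (hi : i + 1 < m) :
    (∃ k l, InRow (rskPerm π).1 k (i + 1) ∧ InRow (rskPerm π).1 l (i + 1 + 1) ∧ k < l) ↔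
      π.symm ⟨i + 1, hi⟩ < π.symm ⟨i, by omega⟩ := by
  rw [rskPerm_eq_rskWord, descent_insertion_iff (permWord_nodup π), permWord, List.pairwise_ofFn]
  push Not
  constructor
  · rintro ⟨j, k, hjk, h₁, h₂⟩
    have hj : π j = ⟨i + 1, hi⟩ := Fin.ext (by simpa using h₁)
    have hk : π k = ⟨i, by omega⟩ := Fin.ext (by simpa using h₂)
    rwa [← hj, ← hk, Equiv.symm_apply_apply, Equiv.symm_apply_apply]
  · intro h
    exact ⟨_, _, h, by simp, by simp⟩

/-- Schensted's theorem, with an increasing subsequence given by its set of positions. -/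
lemma numColumns_rskPerm_le_iff {m : ℕ} (π : Equiv.Perm (Fin m)) (d : ℕ) :
    numColumns (rskPerm π).1 ≤ d ↔ ∀ S : Finset (Fin m), StrictMonoOn π S → S.card ≤ d := by
  rw [rskPerm_eq_rskWord, numColumns_rskWord_le_iff]
  constructor
  · intro h S hS
    have hsub : (S.sort (· ≤ ·)).Sublist (List.finRange m) :=
      List.sublist_of_subperm_of_pairwise (r := (· ≤ ·))
        (List.subperm_of_subset (S.sort_nodup _) fun i _ => List.mem_finRange i)
        (S.pairwise_sort _) ((List.pairwise_lt_finRange m).imp le_of_lt)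
    have h₁ := h ((S.sort (· ≤ ·)).map fun i => (π i : ℕ) + 1)
      (by rw [permWord, List.ofFn_eq_map]; exact hsub.map _) (by
        rw [List.pairwise_map]
        refine (S.pairwise_sort (· ≤ ·)).imp_of_mem fun {a b} ha hb hab => ?_
        rw [Finset.mem_sort] at ha hb
        simpa using hS.monotoneOn ha hb hab)
    simpa using h₁
  · intro h s hs hp
    rw [permWord, List.ofFn_eq_map, List.sublist_map_iff] at hs
    obtain ⟨t, ht, rfl⟩ := hs
    have htlt : t.Pairwise (· < ·) := (List.pairwise_lt_finRange m).sublist ht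
    have hnd : t.Nodup := (List.nodup_finRange m).sublist ht
    rw [List.pairwise_map] at hp
    have hcard := h t.toFinset ?_
    · rwa [List.toFinset_card_of_nodup hnd, ← List.length_map (f := fun i => (π i : ℕ) + 1)]
        at hcard
    · intro a ha b hb hab
      simp only [List.coe_toFinset, Set.mem_ofPred_eq] at ha hb
      obtain ⟨i, hi, rfl⟩ := List.getElem_of_mem ha
      obtain ⟨j, hj, rfl⟩ := List.getElem_of_mem hb
      have hij : i < j := by
        by_contra hji
        rcases (not_lt.1 hji).eq_or_lt with rfl | hji
        · exact absurd hab (lt_irrefl _)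
        · exact absurd (List.pairwise_iff_getElem.1 htlt j i hj hi hji) hab.not_gt
      have h₁ := List.pairwise_iff_getElem.1 hp i j hi hj hij
      have h₂ : π t[i] ≤ π t[j] := by simpa using h₁
      exact lt_of_le_of_ne h₂ fun h => hab.ne (π.injective h)

/-! ### Configurations and multigraphs -/

section SumAbove

variable {α : Type*} [Fintype α] [LinearOrder α]

/-- The sum of the values of `f` at the elements above `v`. As `v` decreases, the intervals
`[sumAbove f v, sumAbove f v + f v)` succeed each other and partition `[0, ∑ v, f v)`. -/
def sumAbove (f : α → ℕ) (v : α) : ℕ := ∑ v' ∈ Finset.univ.filter (fun v' => v < v'), f v'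

lemma sumAbove_add_le (f : α → ℕ) {v w : α} (h : v < w) : sumAbove f w + f w ≤ sumAbove f v := by
  have hw : w ∉ Finset.univ.filter (fun v' => w < v') := by simp
  rw [sumAbove, add_comm, ← Finset.sum_insert hw]
  refine Finset.sum_le_sum_of_subset fun x hx => ?_
  simp only [Finset.mem_insert, Finset.mem_filter, Finset.mem_univ, true_and] at hx ⊢
  rcases hx with rfl | hx
  · exact h
  · exact h.trans hx

lemma sumAbove_add_le_sum (f : α → ℕ) (v : α) : sumAbove f v + f v ≤ ∑ w, f w := by
  have hv : v ∉ Finset.univ.filter (fun v' => v < v') := by simp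
  rw [sumAbove, add_comm, ← Finset.sum_insert hv]
  exact Finset.sum_le_sum_of_subset (Finset.subset_univ _)

lemma exists_sumAbove_le (f : α → ℕ) {a : ℕ} (h : a < ∑ v, f v) :
    ∃ v, sumAbove f v ≤ a ∧ a < sumAbove f v + f v := by
  have hne : (Finset.univ : Finset α).Nonempty := by
    rw [Finset.nonempty_iff_ne_empty]
    intro h0
    simp [h0] at h
  have hS : (Finset.univ.filter fun v => a < sumAbove f v + f v).Nonempty := by
    refine ⟨Finset.univ.min' hne, ?_⟩
    rw [Finset.mem_filter]
    refine ⟨Finset.mem_univ _, ?_⟩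
    set m := Finset.univ.min' hne
    have hm : m ∉ Finset.univ.filter (fun v' => m < v') := by simp
    rw [sumAbove, add_comm, ← Finset.sum_insert hm]
    convert h using 2
    ext x
    simpa [eq_comm] using (Finset.min'_le Finset.univ x (Finset.mem_univ x)).eq_or_lt
  set v := Finset.max' _ hS with hv
  have hvS := Finset.max'_mem _ hS
  rw [← hv, Finset.mem_filter] at hvS
  refine ⟨v, ?_, hvS.2⟩
  by_contra hlt
  rw [not_le] at hlt
  have hne' : (Finset.univ.filter (fun v' => v < v')).Nonempty := by
    rw [Finset.nonempty_iff_ne_empty]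
    intro h0
    simp [sumAbove, h0] at hlt
  -- the successor of `v` contradicts the maximality of `v`
  set w := Finset.min' _ hne' with hw
  have hwm := Finset.min'_mem _ hne'
  rw [← hw, Finset.mem_filter] at hwm
  have hsum : sumAbove f v = sumAbove f w + f w := by
    have hw' : w ∉ Finset.univ.filter (fun v' => w < v') := by simp
    rw [sumAbove, sumAbove, add_comm, ← Finset.sum_insert hw']
    congr 1
    ext x
    simp only [Finset.mem_insert, Finset.mem_filter, Finset.mem_univ, true_and]
    constructor
    · intro hx
      exact (Finset.min'_le _ x (by simpa using hx)).eq_or_lt.imp Eq.symm id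
    · rintro (rfl | hx)
      · exact hwm.2
      · exact hwm.2.trans hx
  exact absurd (Finset.le_max' _ w (by simpa [← hsum] using hlt)) (not_le.2 hwm.2)

lemma sumAbove_unique {f : α → ℕ} {a : ℕ} {v w : α} (hv : sumAbove f v ≤ a)
    (hv' : a < sumAbove f v + f v) (hw : sumAbove f w ≤ a) (hw' : a < sumAbove f w + f w) :
    v = w := by
  rcases lt_trichotomy v w with h | h | h
  · have := sumAbove_add_le f h
    omega
  · exact h
  · have := sumAbove_add_le f h
    omega

end SumAbove

lemma proj_symm {U V : Type*} [LinearOrder U] [LinearOrder V] {r : ℕ}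
    (F : Configuration U V r) :
    Configuration.proj F.symm = fun v u => F.proj u v := by
  funext v u
  refine Finset.card_nbij' (fun b => (ofLex (F.symm (toLex (v, b)))).2)
    (fun a => (ofLex (F (toLex (u, a)))).2) ?_ ?_ ?_ ?_
  all_goals
    intro a ha
    simp only [Finset.coe_filter, Finset.mem_univ, true_and, Set.mem_ofPred_eq] at ha ⊢
    subst ha
    simp

lemma sum_proj {U V : Type*} [Fintype V] [LinearOrder V] {r : ℕ} (F : Configuration U V r)
    (u : U) : ∑ v, F.proj u v = r := by
  have h := Finset.card_eq_sum_card_fiberwise (s := (Finset.univ : Finset (Fin r)))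
    (t := (Finset.univ : Finset V)) (f := fun a => (ofLex (F (toLex (u, a)))).1)
    (fun _ _ => Finset.mem_coe.2 (Finset.mem_univ _))
  rw [Finset.card_univ, Fintype.card_fin] at h
  exact h.symm

/-- The configuration `F` is decreasing on the block `{u} × [r]` of every `u`. -/
def IsBlockDecreasing {U V : Type*} [LinearOrder V] {r : ℕ} (F : Configuration U V r) : Prop :=
  ∀ (u : U) (a b : Fin r), a < b → F (toLex (u, b)) < F (toLex (u, a))

/-- The place of `u^a` in its block is determined by the number of edges at `u` that lead above the
partner of `u^a`, and the number of edges parallel to its own that are used before. -/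
lemma IsBlockDecreasing.val_eq {U V : Type*} [Fintype V] [LinearOrder V] {r : ℕ}
    {F : Configuration U V r} (hF : IsBlockDecreasing F) {u : U} {v : V} {a b : Fin r} (h : F (toLex (u, a)) = toLex (v, b)) :
    (a : ℕ) = sumAbove (F.proj u) v +
      (Finset.univ.filter fun a' => a' < a ∧ (ofLex (F (toLex (u, a')))).1 = v).card := by
  have h₁ : sumAbove (F.proj u) v =
      (Finset.univ.filter fun a' => v < (ofLex (F (toLex (u, a')))).1).card := by
    rw [Finset.card_eq_sum_card_fiberwise (t := Finset.univ.filter fun v' => v < v')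
      (f := fun a' => (ofLex (F (toLex (u, a')))).1) (fun x hx => by simpa using hx), sumAbove]
    refine Finset.sum_congr rfl fun v' hv' => ?_
    rw [Finset.mem_filter] at hv'
    rw [Configuration.proj, Finset.filter_filter]
    congr 1
    ext a'
    simp only [Finset.mem_filter, Finset.mem_univ, true_and]
    constructor
    · rintro rfl
      exact ⟨hv'.2, rfl⟩
    · exact fun h => h.2
  rw [h₁, ← Finset.card_union_of_disjoint]
  · conv_lhs => rw [← Fin.card_Iio a]
    congr 1
    ext a'
    simp only [Finset.mem_Iio, Finset.mem_union, Finset.mem_filter, Finset.mem_univ, true_and]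
    constructor
    · intro haa'
      have := hF u a' a haa'
      rw [h, Prod.Lex.lt_iff] at this
      rcases this with hlt | ⟨heq, -⟩
      · exact Or.inl hlt
      · exact Or.inr ⟨haa', heq.symm⟩
    · rintro (hlt | ⟨haa', -⟩)
      · by_contra hle
        rcases (not_lt.1 hle).eq_or_lt with rfl | hlt'
        · rw [h] at hlt
          exact lt_irrefl _ hlt
        · have := hF u a a' hlt'
          rw [h] at this
          exact absurd (this.trans (Prod.Lex.lt_iff.2 (Or.inl hlt))) (lt_irrefl _)
      · exact haa'
  · rw [Finset.disjoint_left]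
    intro a' h₁ h₂
    simp only [Finset.mem_filter, Finset.mem_univ, true_and] at h₁ h₂
    exact h₁.ne' h₂.2

section Configurations

variable {U V : Type*} [Fintype U] [LinearOrder U] [Fintype V] [LinearOrder V] {r : ℕ}

lemma isAssociated_iff (G : BipMultigraph U V) (F : Configuration U V r) :
    IsAssociated G F ↔ F.proj = G ∧ ∀ u v c, c < G u v → ∃ a b : Fin r,
      (a : ℕ) = sumAbove (G u) v + c ∧
      (b : ℕ) = sumAbove (fun u' => G u' v) u + (G u v - 1 - c) ∧
      F (toLex (u, a)) = toLex (v, b) := by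
  refine and_congr_right fun _ => forall₂_congr fun u v => ⟨fun h c hc => ?_, fun h s hs => ?_⟩
  · obtain ⟨a, b, ha, hb, hF⟩ := h (c + 1) (by rw [Finset.mem_Icc]; omega)
    exact ⟨a, b, by rw [sumAbove]; omega, by rw [sumAbove]; omega, hF⟩
  · rw [Finset.mem_Icc] at hs
    obtain ⟨a, b, ha, hb, hF⟩ := h (s - 1) (by omega)
    rw [sumAbove] at ha hb
    exact ⟨a, b, by omega, by omega, hF⟩

lemma isRegular_proj (F : Configuration U V r) : IsRegular r F.proj := by
  refine ⟨sum_proj F, fun v => ?_⟩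
  have h := sum_proj (Equiv.symm F : Configuration V U r) v
  rwa [proj_symm] at h

lemma IsAssociated.symm {G : BipMultigraph U V} {F : Configuration U V r} (h : IsAssociated G F) :
    IsAssociated (fun v u => G u v) (Equiv.symm F : Configuration V U r) := by
  rw [isAssociated_iff] at h ⊢
  obtain ⟨rfl, h⟩ := h
  refine ⟨proj_symm F, fun v u c hc => ?_⟩
  obtain ⟨a, b, ha, hb, hF⟩ := h u v (F.proj u v - 1 - c) (by omega)
  exact ⟨b, a, by omega, by omega, by rw [← hF, Equiv.symm_apply_apply]⟩

lemma IsAssociated.exists_apply_eq {G : BipMultigraph U V} {F : Configuration U V r}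
    (h : IsAssociated G F) (u : U) (a : Fin r) : ∃ v c, ∃ b : Fin r, c < G u v ∧
      (a : ℕ) = sumAbove (G u) v + c ∧
      (b : ℕ) = sumAbove (fun u' => G u' v) u + (G u v - 1 - c) ∧
      F (toLex (u, a)) = toLex (v, b) := by
  have hreg : IsRegular r G := h.1 ▸ isRegular_proj F
  rw [isAssociated_iff] at h
  obtain ⟨v, hv, hv'⟩ := exists_sumAbove_le (G u) (a := a) (by rw [hreg.1 u]; exact a.isLt)
  obtain ⟨a', b, ha, hb, hF⟩ := h.2 u v (a - sumAbove (G u) v) (by omega)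
  obtain rfl : a' = a := Fin.ext (by omega)
  exact ⟨v, _, b, by omega, by omega, hb, hF⟩

lemma IsAssociated.unique {G : BipMultigraph U V} {F F' : Configuration U V r}
    (h : IsAssociated G F) (h' : IsAssociated G F') : F = F' := by
  apply Equiv.ext
  intro x
  obtain ⟨v, c, b, hc, ha, hb, hF⟩ := h.exists_apply_eq (ofLex x).1 (ofLex x).2
  obtain ⟨v', c', b', hc', ha', hb', hF'⟩ := h'.exists_apply_eq (ofLex x).1 (ofLex x).2
  obtain rfl : v = v' := sumAbove_unique (f := G (ofLex x).1) (a := (ofLex x).2)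
    (by omega) (by omega) (by omega) (by omega)
  obtain rfl : c = c' := by omega
  obtain rfl : b = b' := Fin.ext (by omega)
  exact hF.trans hF'.symm

lemma IsAssociated.isBlockDecreasing {G : BipMultigraph U V} {F : Configuration U V r}
    (h : IsAssociated G F) : IsBlockDecreasing F := by
  intro u a a' haa'
  obtain ⟨v, c, b, hc, ha, hb, hF⟩ := h.exists_apply_eq u a
  obtain ⟨v', c', b', hc', ha', hb', hF'⟩ := h.exists_apply_eq u a'
  have haa' : (a : ℕ) < a' := haa'
  rw [hF, hF', Prod.Lex.toLex_lt_toLex]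
  rcases lt_trichotomy v v' with hv | rfl | hv
  · have := sumAbove_add_le (G u) hv
    omega
  · refine Or.inr ⟨rfl, ?_⟩
    change (b' : ℕ) < b
    omega
  · exact Or.inl hv

/-- A configuration that is decreasing on the blocks of both sides is associated to its
projection. -/
lemma isAssociated_proj {F : Configuration U V r} (hF : IsBlockDecreasing F)
    (hF' : IsBlockDecreasing (Equiv.symm F : Configuration V U r)) : IsAssociated F.proj F := by
  have key : ∀ (u : U) (a : Fin r) (v : V) (b : Fin r), F (toLex (u, a)) = toLex (v, b) →
      ∃ c < F.proj u v, (a : ℕ) = sumAbove (F.proj u) v + c ∧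
        (b : ℕ) = sumAbove (fun u' => F.proj u' v) u + (F.proj u v - 1 - c) := by
    intro u a v b h
    have h' : F.symm (toLex (v, b)) = toLex (u, a) := by rw [← h, Equiv.symm_apply_apply]
    have ha := hF.val_eq h
    have hb := hF'.val_eq h'
    rw [proj_symm] at hb
    beta_reduce at hb
    -- the parallel edges that come before on the side of `V` are those that come after on the
    -- side of `U`
    have hcard : (Finset.univ.filter fun b' => b' < b ∧ (ofLex (F.symm (toLex (v, b')))).1 = u).card
        = (Finset.univ.filter fun a' => a < a' ∧ (ofLex (F (toLex (u, a')))).1 = v).card := by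
      refine Finset.card_nbij' (fun b' => (ofLex (F.symm (toLex (v, b')))).2)
        (fun a' => (ofLex (F (toLex (u, a')))).2) ?_ ?_ ?_ ?_
      · intro b' hb'
        simp only [Finset.coe_filter, Finset.mem_univ, true_and, Set.mem_ofPred_eq] at hb' ⊢
        have h₁ := hF' v b' b hb'.1
        rw [h', Prod.Lex.lt_iff] at h₁
        have h₂ := h₁.resolve_left (by simp [hb'.2])
        exact ⟨h₂.2, by simp [← hb'.2]⟩
      · intro a' ha'
        simp only [Finset.coe_filter, Finset.mem_univ, true_and, Set.mem_ofPred_eq] at ha' ⊢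
        have h₁ := hF u a a' ha'.1
        rw [h, Prod.Lex.lt_iff] at h₁
        have h₂ := h₁.resolve_left (by simp [ha'.2])
        exact ⟨h₂.2, by simp [← ha'.2]⟩
      · intro b' hb'
        simp only [Finset.coe_filter, Finset.mem_univ, true_and, Set.mem_ofPred_eq] at hb'
        simp [← hb'.2]
      · intro a' ha'
        simp only [Finset.coe_filter, Finset.mem_univ, true_and, Set.mem_ofPred_eq] at ha'
        simp [← ha'.2]
    have htotal : F.proj u v =
        (Finset.univ.filter fun a' => a' < a ∧ (ofLex (F (toLex (u, a')))).1 = v).card +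
        (Finset.univ.filter fun a' => a < a' ∧ (ofLex (F (toLex (u, a')))).1 = v).card + 1 := by
      rw [← Finset.card_union_of_disjoint, ← Finset.card_insert_of_notMem (a := a)]
      · rw [Configuration.proj]
        congr 1
        ext a'
        simp only [Finset.mem_insert, Finset.mem_union, Finset.mem_filter, Finset.mem_univ,
          true_and]
        rcases lt_trichotomy a' a with hlt | rfl | hlt
        · simp [hlt, hlt.ne, hlt.not_gt]
        · simp [h]
        · simp [hlt, hlt.ne', hlt.not_gt]
      · simp
      · rw [Finset.disjoint_left]
        intro a' h₁ h₂
        simp only [Finset.mem_filter, Finset.mem_univ, true_and] at h₁ h₂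
        exact lt_asymm h₁.1 h₂.1
    exact ⟨_, by omega, ha, by omega⟩
  rw [isAssociated_iff]
  refine ⟨rfl, fun u v c hc => ?_⟩
  have hr := sumAbove_add_le_sum (F.proj u) v
  rw [(isRegular_proj F).1 u] at hr
  set a : Fin r := ⟨sumAbove (F.proj u) v + c, by omega⟩ with ha
  obtain ⟨v', b, hvb⟩ : ∃ v' b, F (toLex (u, a)) = toLex (v', b) := ⟨_, _, rfl⟩
  obtain ⟨c', hc', ha', hb⟩ := key u a v' b hvb
  have hval : (a : ℕ) = sumAbove (F.proj u) v + c := rfl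
  obtain rfl : v = v' := sumAbove_unique (f := F.proj u) (a := a)
    (by omega) (by omega) (by omega) (by omega)
  obtain rfl : c = c' := by omega
  exact ⟨a, b, hval, hb, hvb⟩

/-- Every regular multigraph has an associated configuration. -/
lemma IsRegular.exists_isAssociated {G : BipMultigraph U V} (hG : IsRegular r G)
    (hcard : Fintype.card U = Fintype.card V) : ∃ F : Configuration U V r, IsAssociated G F := by
  have hex : ∀ x : U ×ₗ Fin r, ∃ (y : V ×ₗ Fin r) (c : ℕ), c < G (ofLex x).1 (ofLex y).1 ∧
      ((ofLex x).2 : ℕ) = sumAbove (G (ofLex x).1) (ofLex y).1 + c ∧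
      ((ofLex y).2 : ℕ) = sumAbove (fun u' => G u' (ofLex y).1) (ofLex x).1 +
        (G (ofLex x).1 (ofLex y).1 - 1 - c) := by
    intro x
    obtain ⟨v, hv, hv'⟩ := exists_sumAbove_le (G (ofLex x).1) (a := (ofLex x).2)
      (by rw [hG.1]; exact (ofLex x).2.isLt)
    have hr := sumAbove_add_le_sum (fun u' => G u' v) (ofLex x).1
    rw [hG.2 v] at hr
    exact ⟨toLex (v, ⟨sumAbove (fun u' => G u' v) (ofLex x).1 +
      (G (ofLex x).1 v - 1 - ((ofLex x).2 - sumAbove (G (ofLex x).1) v)), by omega⟩),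
      (ofLex x).2 - sumAbove (G (ofLex x).1) v, by simp; omega, by simp; omega, rfl⟩
  choose f c hc hx hf using hex
  have hinj : Function.Injective f := by
    intro x y hxy
    have hcx := hc x
    have hcy := hc y
    have hfx := hf x
    have hfy := hf y
    have hxx := hx x
    have hyy := hx y
    rw [hxy] at hcx hfx hxx
    have hu : (ofLex x).1 = (ofLex y).1 :=
      sumAbove_unique (f := fun u' => G u' (ofLex (f y)).1) (a := (ofLex (f y)).2)
        (by omega) (by omega) (by omega) (by omega)
    rw [hu] at hcx hfx hxx
    refine ofLex.injective (Prod.ext hu (Fin.ext ?_))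
    omega
  have hbij : Function.Bijective f :=
    (Fintype.bijective_iff_injective_and_card f).2 ⟨hinj, by simp [hcard]⟩
  have hcol : ∀ u v (a : Fin r), (ofLex (f (toLex (u, a)))).1 = v ↔
      sumAbove (G u) v ≤ a ∧ (a : ℕ) < sumAbove (G u) v + G u v := by
    intro u v a
    have h₁ := hc (toLex (u, a))
    have h₂ := hx (toLex (u, a))
    rw [ofLex_toLex] at h₁ h₂
    dsimp only at h₁ h₂
    constructor
    · rintro rfl
      omega
    · rintro ⟨h₃, h₄⟩
      exact sumAbove_unique (f := G u) (a := a) (by omega) (by omega) h₃ h₄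
  refine ⟨Equiv.ofBijective f hbij, (isAssociated_iff _ _).2 ⟨?_, fun u v s hs => ?_⟩⟩
  · funext u v
    have hr := sumAbove_add_le_sum (G u) v
    rw [hG.1 u] at hr
    have hmap : (Finset.univ.filter fun a : Fin r => (ofLex (f (toLex (u, a)))).1 = v).map
        Fin.valEmbedding = Finset.Ico (sumAbove (G u) v) (sumAbove (G u) v + G u v) := by
      ext a
      simp only [Finset.mem_map, Finset.mem_filter, Finset.mem_univ, true_and, hcol,
        Fin.valEmbedding_apply, Finset.mem_Ico]
      exact ⟨by rintro ⟨a, h, rfl⟩; exact h, fun h => ⟨⟨a, by omega⟩, h, rfl⟩⟩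
    have := congrArg Finset.card hmap
    rw [Finset.card_map, Nat.card_Ico, Nat.add_sub_cancel_left] at this
    exact this
  · have hr := sumAbove_add_le_sum (G u) v
    rw [hG.1 u] at hr
    have hv := (hcol u v ⟨sumAbove (G u) v + s, by omega⟩).2 ⟨by simp, by simpa using hs⟩
    have h₁ := hx (toLex (u, ⟨sumAbove (G u) v + s, by omega⟩))
    have h₂ := hf (toLex (u, ⟨sumAbove (G u) v + s, by omega⟩))
    rw [hv] at h₁ h₂
    rw [ofLex_toLex] at h₁ h₂
    have hs' : c (toLex (u, ⟨sumAbove (G u) v + s, by omega⟩)) = s := by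
      simpa using h₁.symm
    rw [hs'] at h₂
    refine ⟨⟨sumAbove (G u) v + s, by omega⟩, _, rfl, h₂, ?_⟩
    exact ofLex.injective (Prod.ext hv rfl)

/-! ### Planar matchings and increasing subsequences -/

lemma largestPlanarMatching_le_iff (G : BipMultigraph U V) (d : ℕ) :
    largestPlanarMatching G ≤ d ↔ ∀ M, IsPlanarMatching G M → M.card ≤ d := by
  simp [largestPlanarMatching, Finset.sup_le_iff]

/-- Planar matchings of the projection correspond to increasing subsequences of the configuration:
as it is decreasing on the blocks of both sides, an increasing subsequence meets every block at
most once. -/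
lemma largestPlanarMatching_proj_le_iff {F : Configuration U V r} (hF : IsBlockDecreasing F)
    (hF' : IsBlockDecreasing (Equiv.symm F : Configuration V U r)) (d : ℕ) :
    largestPlanarMatching F.proj ≤ d ↔
      ∀ S : Finset (U ×ₗ Fin r), StrictMonoOn F S → S.card ≤ d := by
  classical
  rw [largestPlanarMatching_le_iff]
  constructor
  · intro h S hS
    have hlt : ∀ x ∈ S, ∀ y ∈ S, x < y →
        (ofLex x).1 < (ofLex y).1 ∧ (ofLex (F x)).1 < (ofLex (F y)).1 := by
      intro x hx y hy hxy
      have hFxy := hS hx hy hxy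
      constructor
      · rcases Prod.Lex.lt_iff.1 hxy with hlt | ⟨heq, hlt⟩
        · exact hlt
        · have h₁ := hF (ofLex x).1 _ _ hlt
          nth_rewrite 1 [heq] at h₁
          exact absurd (h₁.trans hFxy) (lt_irrefl _)
      · rcases Prod.Lex.lt_iff.1 hFxy with hlt | ⟨heq, hlt⟩
        · exact hlt
        · have h₁ := hF' (ofLex (F x)).1 _ _ hlt
          nth_rewrite 1 [heq] at h₁
          simp only [Prod.mk.eta, toLex_ofLex, Equiv.symm_apply_apply] at h₁
          exact absurd (h₁.trans hxy) (lt_irrefl _)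
    have hinj : Set.InjOn (fun x : U ×ₗ Fin r => ((ofLex x).1, (ofLex (F x)).1)) S := by
      intro x hx y hy hxy
      by_contra hne
      simp only [Prod.mk.injEq] at hxy
      rcases lt_or_gt_of_ne hne with hxy' | hxy'
      · exact (hlt x hx y hy hxy').1.ne hxy.1
      · exact (hlt y hy x hx hxy').1.ne' hxy.1
    rw [← Finset.card_image_of_injOn hinj]
    apply h
    refine ⟨?_, ?_⟩
    · intro e he
      obtain ⟨x, -, rfl⟩ := Finset.mem_image.1 he
      exact Finset.card_pos.2 ⟨(ofLex x).2, by simp⟩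
    · intro e he e' he' hne
      obtain ⟨x, hx, rfl⟩ := Finset.mem_image.1 (Finset.mem_coe.1 he)
      obtain ⟨y, hy, rfl⟩ := Finset.mem_image.1 (Finset.mem_coe.1 he')
      rcases lt_trichotomy x y with hxy | rfl | hxy
      · exact Or.inl (hlt x hx y hy hxy)
      · exact absurd rfl hne
      · exact Or.inr (hlt y hy x hx hxy)
  · intro h M hM
    have hex : ∀ e : M, ∃ a : Fin r, (ofLex (F (toLex (e.1.1, a)))).1 = e.1.2 := by
      intro e
      obtain ⟨a, ha⟩ := Finset.card_pos.1 (hM.1 e.1 e.2)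
      exact ⟨a, (Finset.mem_filter.1 ha).2⟩
    choose a ha using hex
    have hinj : Function.Injective fun e : M => toLex (e.1.1, a e) := by
      intro e e' hee'
      have h₁ : e.1.1 = e'.1.1 := congrArg (fun x => (ofLex x).1) hee'
      by_contra hne
      rcases hM.2 e.2 e'.2 (fun h => hne (Subtype.ext h)) with hlt | hlt
      · exact hlt.1.ne h₁
      · exact hlt.1.ne' h₁
    have hcard := h (Finset.univ.image fun e : M => toLex (e.1.1, a e)) ?_
    · rwa [Finset.card_image_of_injective _ hinj, Finset.card_univ, Fintype.card_coe] at hcard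
    · intro x hx y hy hxy
      obtain ⟨e, -, rfl⟩ := Finset.mem_image.1 (Finset.mem_coe.1 hx)
      obtain ⟨e', -, rfl⟩ := Finset.mem_image.1 (Finset.mem_coe.1 hy)
      have hne : e.1 ≠ e'.1 := fun h => hxy.ne (by rw [Subtype.ext h])
      rcases hM.2 e.2 e'.2 hne with hlt | hlt
      · rw [Prod.Lex.lt_iff, ha, ha]
        exact Or.inl hlt.2
      · exact absurd (hxy.trans (Prod.Lex.toLex_lt_toLex.2 (Or.inl hlt.1))) (lt_irrefl _)

end Configurations

/-! ### Blocks of positions -/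

lemma mul_add_lt_mul {r n q a : ℕ} (hq : q < n) (ha : a < r) : r * q + a < r * n :=
  calc r * q + a < r * (q + 1) := by rw [mul_add_one]; omega
    _ ≤ r * n := Nat.mul_le_mul_left r hq

lemma finOrderIso_apply {U : Type*} [Fintype U] [LinearOrder U] {r n : ℕ}
    (hU : Fintype.card U = n) (q : Fin n)
    (a : Fin r) : finOrderIso r hU ⟨r * q + a, mul_add_lt_mul q.isLt a.isLt⟩ =
      toLex (monoEquivOfFin U hU q, a) := by
  let g : U ×ₗ Fin r → Fin (r * n) := fun x =>
    ⟨r * ((monoEquivOfFin U hU).symm (ofLex x).1 : Fin n) + (ofLex x).2,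
      mul_add_lt_mul (Fin.isLt _) (Fin.isLt _)⟩
  have hg : StrictMono g := by
    intro x y hxy
    rw [Fin.lt_def]
    rcases Prod.Lex.lt_iff.1 hxy with hlt | ⟨heq, hlt⟩
    · have h₁ := (monoEquivOfFin U hU).symm.strictMono hlt
      have h₂ := mul_add_lt_mul (r := r) (Fin.lt_def.1 h₁) (ofLex x).2.isLt
      exact h₂.trans_le (Nat.le_add_right _ _)
    · change r * ((monoEquivOfFin U hU).symm (ofLex x).1 : ℕ) + ((ofLex x).2 : ℕ) <
        r * ((monoEquivOfFin U hU).symm (ofLex y).1 : ℕ) + ((ofLex y).2 : ℕ)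
      rw [heq]
      exact Nat.add_lt_add_left hlt _
  have hbij : Function.Bijective g :=
    (Fintype.bijective_iff_injective_and_card g).2 ⟨hg.injective, by simp [hU, mul_comm]⟩
  let e : U ×ₗ Fin r ≃o Fin (r * n) := hg.orderIsoOfSurjective g hbij.2
  have he : finOrderIso r hU = e.symm := Subsingleton.elim _ _
  rw [he, OrderIso.symm_apply_eq]
  simp [e, g]

section Blocks

variable {U V : Type*} [Fintype U] [LinearOrder U] [Fintype V] [LinearOrder V] {r n : ℕ}

lemma toPerm_lt_toPerm_iff (hU : Fintype.card U = n) (hV : Fintype.card V = n)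
    (F : Configuration U V r) (i j : Fin (r * n)) :
    F.toPerm hU hV i < F.toPerm hU hV j ↔ F (finOrderIso r hU i) < F (finOrderIso r hU j) :=
  (finOrderIso r hV).symm.lt_iff_lt

/-- It suffices to compare consecutive elements of the blocks. The index `r * (i - 1) + (s - 1)` is
that of the letter `r(i - 1) + s` when positions are counted from `0`. -/
lemma isBlockDecreasing_iff (hU : Fintype.card U = n) (hV : Fintype.card V = n)
    (F : Configuration U V r) :
    IsBlockDecreasing F ↔ ∀ i ∈ Finset.Icc 1 n, ∀ s ∈ Finset.Ico 1 r,
      ∃ h : r * (i - 1) + (s - 1) + 1 < r * n,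
        F.toPerm hU hV ⟨r * (i - 1) + (s - 1) + 1, h⟩ <
          F.toPerm hU hV ⟨r * (i - 1) + (s - 1), by omega⟩ := by
  constructor
  · intro hF i hi s hs
    rw [Finset.mem_Icc] at hi
    rw [Finset.mem_Ico] at hs
    refine ⟨mul_add_lt_mul (a := s - 1 + 1) (by omega) (by omega), ?_⟩
    rw [toPerm_lt_toPerm_iff]
    have h₁ := finOrderIso_apply hU ⟨i - 1, by omega⟩ (⟨s - 1, by omega⟩ : Fin r)
    have h₂ := finOrderIso_apply hU ⟨i - 1, by omega⟩ (⟨s - 1 + 1, by omega⟩ : Fin r)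
    simp only [← add_assoc] at h₁ h₂
    rw [h₁, h₂]
    exact hF _ _ _ (by simp [Fin.lt_def])
  · intro h u
    obtain ⟨q, rfl⟩ := (monoEquivOfFin U hU).surjective u
    rcases r with _ | r
    · exact fun a => a.elim0
    · change StrictAnti fun a : Fin (r + 1) => F (toLex (monoEquivOfFin U hU q, a))
      rw [Fin.strictAnti_iff_succ_lt]
      intro c
      obtain ⟨hlt, h₁⟩ := h (q + 1) (by rw [Finset.mem_Icc]; omega) (c + 1)
        (by rw [Finset.mem_Ico]; omega)
      rw [toPerm_lt_toPerm_iff] at h₁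
      rw [← finOrderIso_apply hU, ← finOrderIso_apply hU]
      exact h₁

lemma conditionT_snd_rsk_iff (hU : Fintype.card U = n) (hV : Fintype.card V = n)
    (F : Configuration U V r) :
    ConditionT r n (rsk hU hV F).2 ↔ IsBlockDecreasing F := by
  rw [isBlockDecreasing_iff hU hV]
  refine forall₄_congr fun i hi s hs => ?_
  rw [Finset.mem_Icc] at hi
  rw [Finset.mem_Ico] at hs
  have hlt : r * (i - 1) + (s - 1) + 1 < r * n :=
    mul_add_lt_mul (a := s - 1 + 1) (by omega) (by omega)
  obtain ⟨s, rfl⟩ : ∃ s', s = s' + 1 := ⟨s - 1, by omega⟩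
  exact (descent_snd_rskPerm_iff (F.toPerm hU hV) hlt).trans ⟨fun h => ⟨hlt, h⟩, fun h => h.2⟩

lemma conditionT_fst_rsk_iff (hU : Fintype.card U = n) (hV : Fintype.card V = n)
    (F : Configuration U V r) :
    ConditionT r n (rsk hU hV F).1 ↔ IsBlockDecreasing (Equiv.symm F : Configuration V U r) := by
  rw [isBlockDecreasing_iff hV hU]
  refine forall₄_congr fun i hi s hs => ?_
  rw [Finset.mem_Icc] at hi
  rw [Finset.mem_Ico] at hs
  have hlt : r * (i - 1) + (s - 1) + 1 < r * n :=
    mul_add_lt_mul (a := s - 1 + 1) (by omega) (by omega)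
  obtain ⟨s, rfl⟩ : ∃ s', s = s' + 1 := ⟨s - 1, by omega⟩
  exact (descent_fst_rskPerm_iff (F.toPerm hU hV) hlt).trans ⟨fun h => ⟨hlt, h⟩, fun h => h.2⟩

lemma numColumns_rsk_le_iff (hU : Fintype.card U = n) (hV : Fintype.card V = n)
    (F : Configuration U V r) (d : ℕ) :
    numColumns (rsk hU hV F).1 ≤ d ↔
      ∀ S : Finset (U ×ₗ Fin r), StrictMonoOn F S → S.card ≤ d := by
  rw [rsk, numColumns_rskPerm_le_iff]
  constructor
  · intro h S hS
    rw [← Finset.card_map (finOrderIso r hU).symm.toEquiv.toEmbedding]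
    apply h
    intro i hi j hj hij
    obtain ⟨x, hx, rfl⟩ := Finset.mem_map.1 (Finset.mem_coe.1 hi)
    obtain ⟨y, hy, rfl⟩ := Finset.mem_map.1 (Finset.mem_coe.1 hj)
    have hxy : x < y := (finOrderIso r hU).symm.lt_iff_lt.1 hij
    rw [toPerm_lt_toPerm_iff]
    simpa using hS hx hy hxy
  · intro h S hS
    rw [← Finset.card_map (finOrderIso r hU).toEquiv.toEmbedding]
    apply h
    intro x hx y hy hxy
    obtain ⟨i, hi, rfl⟩ := Finset.mem_map.1 (Finset.mem_coe.1 hx)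
    obtain ⟨j, hj, rfl⟩ := Finset.mem_map.1 (Finset.mem_coe.1 hy)
    have hij : i < j := (finOrderIso r hU).lt_iff_lt.1 hxy
    exact (toPerm_lt_toPerm_iff hU hV F i j).1 (hS hi hj hij)

lemma mem_planarConfigurations_iff (F : Configuration U V r) (d : ℕ) :
    F ∈ planarConfigurations U V r d ↔ IsBlockDecreasing F ∧
      IsBlockDecreasing (Equiv.symm F : Configuration V U r) ∧
      largestPlanarMatching F.proj ≤ d := by
  constructor
  · rintro ⟨G, ⟨-, hd⟩, h⟩
    exact ⟨h.isBlockDecreasing, h.symm.isBlockDecreasing, h.1 ▸ hd⟩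
  · rintro ⟨h₁, h₂, hd⟩
    exact ⟨F.proj, ⟨isRegular_proj F, hd⟩, isAssociated_proj h₁ h₂⟩

lemma rsk_mem_tableauPairs_iff (hU : Fintype.card U = n) (hV : Fintype.card V = n)
    (F : Configuration U V r) (d : ℕ) :
    rsk hU hV F ∈ tableauPairs r n d ↔ F ∈ planarConfigurations U V r d := by
  obtain ⟨hP, hQ, heP, heQ, hs⟩ := rskPerm_spec (F.toPerm hU hV)
  have hcol : numColumns (rsk hU hV F).2 = numColumns (rsk hU hV F).1 := by
    have h : ∀ T, numColumns T = (shape T).headD 0 := by rintro (_ | _) <;> rfl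
    rw [h, h, rsk, hs]
  rw [mem_planarConfigurations_iff]
  constructor
  · rintro ⟨⟨-, -, hd⟩, -, -, hT₁, hT₂⟩
    rw [conditionT_fst_rsk_iff] at hT₁
    rw [conditionT_snd_rsk_iff] at hT₂
    rw [numColumns_rsk_le_iff] at hd
    exact ⟨hT₂, hT₁, (largestPlanarMatching_proj_le_iff hT₂ hT₁ d).2 hd⟩
  · rintro ⟨h₁, h₂, hd⟩
    rw [largestPlanarMatching_proj_le_iff h₁ h₂, ← numColumns_rsk_le_iff hU hV] at hd
    exact ⟨⟨hP, heP, hd⟩, ⟨hQ, heQ, hcol ▸ hd⟩, hs, (conditionT_fst_rsk_iff hU hV F).2 h₂,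
      (conditionT_snd_rsk_iff hU hV F).2 h₁⟩

lemma rsk_injective (hU : Fintype.card U = n) (hV : Fintype.card V = n) :
    Function.Injective (rsk hU hV : Configuration U V r → _) := by
  intro F F' h
  have h := rskPerm_injective h
  apply Equiv.ext
  intro x
  have hx := Equiv.congr_fun h ((finOrderIso r hU).symm x)
  simpa [Configuration.toPerm] using hx

lemma bijOn_rsk (hU : Fintype.card U = n) (hV : Fintype.card V = n) (d : ℕ) :
    Set.BijOn (rsk hU hV) (planarConfigurations U V r d) (tableauPairs r n d) := by
  refine ⟨fun F hF => (rsk_mem_tableauPairs_iff hU hV F d).2 hF, (rsk_injective hU hV).injOn, ?_⟩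
  rintro ⟨P, Q⟩ hPQ
  obtain ⟨⟨hP, heP, -⟩, ⟨hQ, heQ, -⟩, hs, -⟩ := id hPQ
  obtain ⟨π, hπ⟩ := exists_rskPerm_eq hP hQ heP heQ hs
  let F : Configuration U V r :=
    ((finOrderIso r hU).symm.toEquiv.trans π).trans (finOrderIso r hV).toEquiv
  have hF : rsk hU hV F = (P, Q) := by
    rw [← hπ, rsk]
    congr 1
    ext i
    simp [F, Configuration.toPerm]
  exact ⟨F, (rsk_mem_tableauPairs_iff hU hV F d).1 (hF ▸ hPQ), hF⟩

lemma bijOn_proj (hUV : Fintype.card U = Fintype.card V) (d : ℕ) :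
    Set.BijOn (Configuration.proj (U := U) (V := V) (r := r)) (planarConfigurations U V r d)
      (planarMultigraphs U V r d) := by
  refine ⟨?_, ?_, ?_⟩
  · rintro F ⟨G, hG, hF⟩
    rwa [hF.1]
  · rintro F ⟨G, -, hF⟩ F' ⟨G', -, hF'⟩ h
    obtain rfl : G = G' := by rw [← hF.1, ← hF'.1, h]
    exact hF.unique hF'
  · intro G hG
    obtain ⟨F, hF⟩ := hG.1.exists_isAssociated hUV
    exact ⟨F, ⟨G, hG, hF⟩, hF.1⟩

lemma ncard_planarMultigraphs (hU : Fintype.card U = n) (hV : Fintype.card V = n) (d : ℕ) :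
    (planarMultigraphs U V r d).ncard = (tableauPairs r n d).ncard := by
  rw [← (bijOn_proj (hU.trans hV.symm) d).ncard_eq, (bijOn_rsk hU hV d).ncard_eq]

end Blocks

end PlanarMatching

theorem theorem5 {U : Type*} {V : Type*} [Fintype U] [LinearOrder U] [Fintype V] [LinearOrder V]
    (r n d : ℕ) (hU : Fintype.card U = n) (hV : Fintype.card V = n) :
    Set.BijOn (PlanarMatching.rsk hU hV)
        (PlanarMatching.planarConfigurations U V r d) (PlanarMatching.tableauPairs r n d) ∧
      (PlanarMatching.planarMultigraphs U V r d).ncard =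
        PlanarMatching.numPlanarMultigraphs r n d ∧
      PlanarMatching.numPlanarMultigraphs r n d = (PlanarMatching.tableauPairs r n d).ncard := by
  have h : PlanarMatching.numPlanarMultigraphs r n d = (PlanarMatching.tableauPairs r n d).ncard :=
    PlanarMatching.ncard_planarMultigraphs (Fintype.card_fin n) (Fintype.card_fin n) d
  exact ⟨PlanarMatching.bijOn_rsk hU hV d,
    (PlanarMatching.ncard_planarMultigraphs hU hV d).trans h.symm, h⟩
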